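/- **Language.** Let $V$, $C$, $F$ be disjoint sets of symbols (variables, constants, operators); the further symbols are $\{\}$ (one symbol) and $(\;)\;,\;:$. Each $c\in C$ has a meaning $\#(c)$, an object; each $f\in F$ comes with a condition $A_f$ on finite sequences of objects and with a value $P_f$ on the sequences that satisfy it. Objects may be sets or not; a function with $m$ arguments is a function whose domain is a subset of $D^m$ for some set $D$. For finite sequences of pairs, $\varepsilon$ is the empty sequence, $\|$ is concatenation, $\alpha\sqsubseteq\gamma$ means that $\alpha$ is an initial segment of $\gamma$, $\mathrm{dom}(\alpha)$ is the set of first components, and (no first component being repeated) $\alpha(a)$ is the second component that goes with $a$, and $\alpha/B$ is the initial segment of $\alpha$ with domain $B$. **Contexts, states, expressions, meanings.** By recursion on $n\ge 1$ one defines the set $K(n)$ of contexts, the set $\Xi(k)$ of states of $k\in K(n)$, the set $E(n,k)$ of expressions (strings), the meaning $\#(k,t,\sigma)$ for $t\in E(n,k)$, $\sigma\in\Xi(k)$, and the set $V_b(t)$ of bound variables of $t$. Start: $K(1)=\{\varepsilon\}$, $\Xi(\varepsilon)=\{\varepsilon\}$, $E(1,\varepsilon)=C$, $\#(\varepsilon,c,\varepsilon)=\#(c)$,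 $V_b(c)=\emptyset$. Step: $K(n+1)=K(n)\cup K(n)^+$, where $K(n)^+$ consists of all $k=h\|(y,\varphi)$ with $h\in K(n)$, $\varphi\in E(n,h)$, $y\in V\setminus\mathrm{dom}(h)$ and $\#(h,\varphi,\rho)$ a set for all $\rho\in\Xi(h)$; for these $\Xi(k)=\{\sigma\|(y,s):\sigma\in\Xi(h),\,s\in\#(h,\varphi,\sigma)\}$. $E(n+1,k)$ consists of $E(n,k)$ (if $k\in K(n)$) and of: - (a) if $k=h\|(y,\varphi)\in K(n)^+$: all $t\in E(n,h)$ with $y\notin V_b(t)$, with $\#(k,t,\rho\|(y,s))=\#(h,t,\rho)$; - (b) if $k=h\|(y,\varphi)\in K(n)^+$: the variable $y$, with $\#(k,y,\sigma)=\sigma(y)$, $V_b(y)=\emptyset$; - (c) if $k\in K(n)$: the strings $(\psi)(\psi_1,\dots,\psi_m)$, $m\ge1$, with $\psi,\psi_j\in E(n,k)$ such that for all $\sigma\in\Xi(k)$, $\#(k,\psi,\sigma)$ is a function with $m$ arguments whose domain contains $(\#(k,\psi_1,\sigma),\dots,\#(k,\psi_m,\sigma))$; the meaning is the value of that function there, and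 $V_b$ is the union of the $V_b$ of $\psi,\psi_1,\dots,\psi_m$; - (d) if $k\in K(n)$: the strings $(f)(\psi_1,\dots,\psi_m)$, $m\ge1$, with $f\in F$, $\psi_j\in E(n,k)$ such that $A_f(\#(k,\psi_1,\sigma),\dots,\#(k,\psi_m,\sigma))$ for all $\sigma\in\Xi(k)$; the meaning is $P_f(\#(k,\psi_1,\sigma),\dots,\#(k,\psi_m,\sigma))$, and $V_b$ is the union of the $V_b(\psi_j)$; - (e) if $k\in K(n)$: the strings $\{\}(y_1:\psi_1,\dots,y_m:\psi_m,\psi)$, $m\ge1$, with distinct $y_j\in V\setminus\mathrm{dom}(k)$ such that, with $k'_j=k\|(y_1,\psi_1)\|\dots\|(y_j,\psi_j)$ (so $k'_0=k$), all $k'_j\in K(n)$, $\psi_{j+1}\in E(n,k'_j)$ and $\#(k'_j,\psi_{j+1},\cdot)$ is a set on all of $\Xi(k'_j)$ (for $0\le j<m$), and $\psi\in E(n,k'_m)$; the meaning is $\{\#(k'_m,\psi,\sigma'):\sigma'\in\Xi(k'_m),\,\sigma\sqsubseteq\sigma'\}$, and $V_b$ is $\{y_1,\dots,y_m\}$ together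 with the $V_b$ of $\psi_1,\dots,\psi_m,\psi$. Put $K=\bigcup_n K(n)$ and $E(k)=\bigcup_{n:\,k\in K(n)}E(n,k)$. **Defining clauses of substitution.** Let $k\in K$, $x\in\mathrm{dom}(k)$, $t$ a string. For $\varphi\in E(k)$, a value of $\varphi_k\{x/t\}$ is given by each applicable clause, according to the way in which $\varphi$ enters $E(k)$: - (a) $k=h\|(y,\chi)$, $\varphi\in E(h)$, $y\notin V_b(\varphi)$: $\varphi$ if $y=x$, and $\varphi_h\{x/t\}$ if $y\ne x$; - (b) $k=h\|(y,\chi)$, $\varphi=y$: $t$ if $y=x$, and $\varphi$ if $y\neq x$; - (c) $(\psi_k\{x/t\})((\psi_1)_k\{x/t\},\dots,(\psi_m)_k\{x/t\})$; - (d) $(f)((\psi_1)_k\{x/t\},\dots,(\psi_m)_k\{x/t\})$; - (e) $\{\}(y_1:(\psi_1)_{k}\{x/t\},\,y_2:(\psi_2)_{k'_1}\{x/t\},\dots,y_m:(\psi_m)_{k'_{m-1}}\{x/t\},\,\psi_{k'_m}\{x/t\})$. For contexts, $(h\|(x,\chi))\{x/t\}=h$, and $(h\|(y,\chi))\{x/t\}=h\{x/t\}\,\|\,(y,\chi_h\{x/t\})$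 if $y\ne x$. Such an object is *well defined* if the clauses yield exactly one value. **Theorem.** Let $n\ge2$, $k\in K(n)$, $k\ne\varepsilon$. Then $k=(x_1,\varphi_1)\|\dots\|(x_p,\varphi_p)$ with $1\le p<n$, distinct $x_j\in V$ and, with $k_j=(x_1,\varphi_1)\|\dots\|(x_j,\varphi_j)$, for each $j=1,\dots,p$: $k_{j-1}\in K(n-1)$, $\varphi_j\in E(n-1,k_{j-1})$, and $\#(k_{j-1},\varphi_j,\rho)$ is a set for all $\rho\in\Xi(k_{j-1})$; and each $\sigma\in\Xi(k)$ is of the form $(x_1,s_1)\|\dots\|(x_p,s_p)$ with $s_j\in\#(k_{j-1},\varphi_j,\sigma/\mathrm{dom}(k_{j-1}))$. Let $1\le i\le p$ and let $t\in E(k_{i-1})$ be such that - $\#(k_{i-1},t,\rho)\in\#(k_{i-1},\varphi_i,\rho)$ for all $\rho\in\Xi(k_{i-1})$; - $x_j\notin V_b(t)$ for all $j\ne i$; - $V_b(t)\cap V_b(\varphi_j)=\emptyset$ for all $j>i$. Then: 1. $k\{x_i/t\}$ is well defined. If $i=p$, it is $k_{p-1}$. If $i<p$, then $k_{p-1}\{x_i/t\}$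 and $(\varphi_p)_{k_{p-1}}\{x_i/t\}$ are well defined, $k_{p-1}\{x_i/t\}\in K$, $x_p\notin\mathrm{dom}(k_{p-1}\{x_i/t\})$, $(\varphi_p)_{k_{p-1}}\{x_i/t\}\in E(k_{p-1}\{x_i/t\})$, its meaning is a set for every state of $k_{p-1}\{x_i/t\}$, and $k\{x_i/t\}=k_{p-1}\{x_i/t\}\,\|\,(x_p,(\varphi_p)_{k_{p-1}}\{x_i/t\})$. 2. $\mathrm{dom}(k\{x_i/t\})=\mathrm{dom}(k)\setminus\{x_i\}$ and $k\{x_i/t\}\in K$. 3. For $\rho\in\Xi(k\{x_i/t\})$ one has $\rho/\mathrm{dom}(k_{i-1})\in\Xi(k_{i-1})$, and $\sigma_\rho:=(x_1,r_1)\|\dots\|(x_p,r_p)$, where $r_j=\rho(x_j)$ for $j\neq i$ and $r_i=\#(k_{i-1},t,\rho/\mathrm{dom}(k_{i-1}))$, belongs to $\Xi(k)$. 4. For every $\varphi\in E(n,k)$ with $V_b(t)\cap V_b(\varphi)=\emptyset$: - $\varphi_k\{x_i/t\}$ is well defined and belongs to $E(k\{x_i/t\})$; - $\#(k,\varphi,\sigma_\rho)=\#(k\{x_i/t\},\varphi_k\{x_i/t\},\rho)$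 for all $\rho\in\Xi(k\{x_i/t\})$; - $V_b(\varphi_k\{x_i/t\})\subseteq V_b(\varphi)\cup V_b(t)$; - one of the following holds: $\varphi\in C$ and $\varphi_k\{x_i/t\}=\varphi$; or $\varphi\in\mathrm{dom}(k)$ and $\varphi_k\{x_i/t\}$ is $t$ if $\varphi=x_i$ and $\varphi$ otherwise; or there is $\kappa\in K(n-1)$ with $\kappa\sqsubseteq k$, $\varphi\in E(n,\kappa)$, such that $\varphi$ is of one of the forms (c), (d), (e) with respect to $\kappa$ and the step $n-1$ (all conditions stated there being satisfied), and: if $x_i\notin\mathrm{dom}(\kappa)$ then $\varphi_k\{x_i/t\}=\varphi$, while if $x_i\in\mathrm{dom}(\kappa)$ then $\varphi_k\{x_i/t\}$ is the result of the corresponding substitution clause with $\kappa$ in place of $k$, all substituted parts in it being well defined (in the form (e), moreover, $y_j\notin V_b(t)$, $\psi_j\in E(n,\kappa'_{j-1})$, $\psi\in E(n,\kappa'_m)$, and $V_b(t)$ is disjoint from all $V_b(\psi_j)$ and from $V_b(\psi)$, where $\kappa'_j=\kappa\|(y_1,\psi_1)\|\dots\|(y_j,\psi_j)$); - (independence of the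 context) if $h\in K(n)$, $k_i\sqsubseteq h$, $\varphi\in E(n,h)$, and every pair $(y,\psi)$ of $h$ after the $i$-th satisfies $y\notin V_b(t)$ and $V_b(t)\cap V_b(\psi)=\emptyset$, then $\varphi_h\{x_i/t\}$ is well defined and $\varphi_k\{x_i/t\}=\varphi_h\{x_i/t\}$; - if $h\in K(n)$, $\varphi\in E(n,h)$ and $x_i\notin\mathrm{dom}(h)$, then $\varphi_k\{x_i/t\}=\varphi$. -/

import Mathlib

universe u w

namespace SubstLogic

/-! ### Objects

The universe of objects: atoms (individuals which are not sets, for instance the truth values) taken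
from an arbitrary type, and all sets that can be built over them; sets are extensional. -/

/-- Codes for objects: an atom, or the set of a family of objects. -/
inductive PreObj (A : Type w) : Type (max w (u + 1))
  | atom (a : A) : PreObj A
  | set (ι : Type u) (f : ι → PreObj A) : PreObj A

namespace PreObj

variable {A : Type w}

/-- Two codes denote the same object. -/
def Equiv : PreObj.{u, w} A → PreObj.{u, w} A → Prop
  | atom a, atom b => a = b
  | set _ f, set _ g => (∀ i, ∃ j, Equiv (f i) (g j)) ∧ (∀ j, ∃ i, Equiv (f i) (g j))
  | _, _ => False

theorem Equiv.refl (x : PreObj.{u, w} A) : Equiv x x := by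
  induction x with
  | atom a => simp [Equiv]
  | set ι f ih => exact ⟨fun i => ⟨i, ih i⟩, fun i => ⟨i, ih i⟩⟩

theorem Equiv.symm {x : PreObj.{u, w} A} : ∀ {y : PreObj.{u, w} A}, Equiv x y → Equiv y x := by
  induction x with
  | atom a =>
    intro y hy
    cases y with
    | atom b => exact Eq.symm hy
    | set κ g => exact hy
  | set ι f ih =>
    intro y hy
    cases y with
    | atom b => exact hy
    | set κ g =>
      refine ⟨fun j => ?_, fun i => ?_⟩
      · obtain ⟨i, hi⟩ := hy.2 j
        exact ⟨i, ih i hi⟩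
      · obtain ⟨j, hj⟩ := hy.1 i
        exact ⟨j, ih i hj⟩

theorem Equiv.trans {x : PreObj.{u, w} A} :
    ∀ {y z : PreObj.{u, w} A}, Equiv x y → Equiv y z → Equiv x z := by
  induction x with
  | atom a =>
    intro y z hy hz
    cases y with
    | atom b =>
      cases z with
      | atom c => exact Eq.trans hy hz
      | set κ g => exact hz
    | set κ g => exact hy.elim
  | set ι f ih =>
    intro y z hy hz
    cases y with
    | atom b => exact hy.elim
    | set κ g =>
      cases z with
      | atom c => exact hz.elim
      | set l r =>
        refine ⟨fun i => ?_, fun k => ?_⟩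
        · obtain ⟨j, hj⟩ := hy.1 i
          obtain ⟨k, hk⟩ := hz.1 j
          exact ⟨k, ih i hj hk⟩
        · obtain ⟨j, hj⟩ := hz.2 k
          obtain ⟨i, hi⟩ := hy.2 j
          exact ⟨i, ih i hi hj⟩

instance setoid (A : Type w) : Setoid (PreObj.{u, w} A) :=
  ⟨Equiv, Equiv.refl, Equiv.symm, Equiv.trans⟩

/-- The code is one of a set. -/
def IsSet : PreObj.{u, w} A → Prop
  | atom _ => False
  | set _ _ => True

/-- Membership of codes. -/
def Mem (x : PreObj.{u, w} A) : PreObj.{u, w} A → Prop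
  | atom _ => False
  | set _ f => ∃ i, Equiv x (f i)

theorem IsSet.congr {x y : PreObj.{u, w} A} (h : Equiv x y) : IsSet x = IsSet y := by
  cases x <;> cases y <;> first | rfl | exact h.elim

theorem Mem.congr {x x' y y' : PreObj.{u, w} A} (hx : Equiv x x') (hy : Equiv y y') :
    Mem x y = Mem x' y' := by
  cases y with
  | atom a =>
    cases y' with
    | atom b => rfl
    | set κ g => exact hy.elim
  | set ι f =>
    cases y' with
    | atom b => exact hy.elim
    | set κ g =>
      refine propext ⟨?_, ?_⟩
      · rintro ⟨i, hi⟩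
        obtain ⟨j, hj⟩ := hy.1 i
        exact ⟨j, (hx.symm.trans hi).trans hj⟩
      · rintro ⟨j, hj⟩
        obtain ⟨i, hi⟩ := hy.2 j
        exact ⟨i, (hx.trans hj).trans hi.symm⟩

end PreObj

/-- The objects over the atoms `A`. -/
def Obj (A : Type w) : Type (max w (u + 1)) := Quotient (PreObj.setoid.{u, w} A)

namespace Obj

variable {A : Type w}

/-- An atom, as an object. -/
def atom (a : A) : Obj.{u, w} A := Quotient.mk _ (PreObj.atom a)

/-- The object is a set. -/
def IsSet (x : Obj.{u, w} A) : Prop :=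
  Quotient.lift PreObj.IsSet (fun _ _ h => PreObj.IsSet.congr h) x

/-- Membership; an atom has no members. -/
def Mem (x y : Obj.{u, w} A) : Prop :=
  Quotient.lift₂ PreObj.Mem (fun _ _ _ _ h h' => PreObj.Mem.congr h h') x y

instance : Membership (Obj.{u, w} A) (Obj.{u, w} A) := ⟨fun y x => Mem x y⟩

/-- The empty set serves as a default value. -/
instance : Inhabited (Obj.{u, w} A) := ⟨Quotient.mk _ (PreObj.set PEmpty PEmpty.elim)⟩

/-- Sets are extensional. -/
theorem ext {x y : Obj.{u, w} A} (hx : IsSet x) (hy : IsSet y) (h : ∀ z, z ∈ x ↔ z ∈ y) :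
    x = y := by
  induction x using Quotient.inductionOn with | _ x => ?_
  induction y using Quotient.inductionOn with | _ y => ?_
  cases x with
  | atom a => exact hx.elim
  | set ι f =>
    cases y with
    | atom a => exact hy.elim
    | set κ g =>
      refine Quotient.sound ⟨fun i => ?_, fun j => ?_⟩
      · exact (h (Quotient.mk _ (f i))).1 ⟨i, PreObj.Equiv.refl _⟩
      · obtain ⟨i, hi⟩ := (h (Quotient.mk _ (g j))).2 ⟨j, PreObj.Equiv.refl _⟩
        exact ⟨i, hi.symm⟩

/-- The members of an object form a small collection. -/
theorem small_members (x : Obj.{u, w} A) : Small.{u} {z : Obj.{u, w} A | z ∈ x} := by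
  induction x using Quotient.inductionOn with | _ x => ?_
  cases x with
  | atom a =>
    refine small_of_surjective (α := PEmpty.{u + 1}) (f := PEmpty.elim) ?_
    rintro ⟨z, hz⟩
    induction z using Quotient.inductionOn with | _ z => exact hz.elim
  | set ι f =>
    refine small_of_surjective (α := ι)
      (f := fun i => ⟨Quotient.mk _ (f i), i, PreObj.Equiv.refl _⟩) ?_
    rintro ⟨z, hz⟩
    induction z using Quotient.inductionOn with | _ z => ?_
    obtain ⟨i, hi⟩ := hz
    exact ⟨i, Subtype.ext (Quotient.sound hi.symm)⟩

/-- Every small collection of objects is the collection of the members of a set. -/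
theorem exists_set (S : Set (Obj.{u, w} A)) [Small.{u} S] :
    ∃ v : Obj.{u, w} A, IsSet v ∧ ∀ z, z ∈ v ↔ z ∈ S := by
  refine ⟨Quotient.mk _ (PreObj.set (Shrink.{u} S)
    (fun i => ((equivShrink S).symm i : Obj.{u, w} A).out)), trivial, fun z => ?_⟩
  induction z using Quotient.inductionOn with | _ z => ?_
  constructor
  · rintro ⟨i, hi⟩
    have : (Quotient.mk _ z : Obj.{u, w} A) = ((equivShrink S).symm i : Obj.{u, w} A) := by
      rw [← Quotient.out_eq ((equivShrink S).symm i : Obj.{u, w} A)]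
      exact Quotient.sound hi
    rw [this]
    exact ((equivShrink S).symm i).2
  · intro hz
    refine ⟨equivShrink S ⟨_, hz⟩, ?_⟩
    have h1 : (Quotient.mk _ z : Obj.{u, w} A) =
        Quotient.mk _ ((equivShrink S).symm (equivShrink S ⟨_, hz⟩) : Obj.{u, w} A).out := by
      have h0 := congrArg Subtype.val ((equivShrink S).symm_apply_apply ⟨_, hz⟩)
      exact h0.symm.trans (Quotient.out_eq _).symm
    exact Quotient.exact h1

open Classical in
/-- The set `{z | z ∈ S}`; by `exists_set` it exists whenever the collection `S` is small. -/
noncomputable def mkSet (S : Set (Obj.{u, w} A)) : Obj.{u, w} A :=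
  if h : ∃ v : Obj.{u, w} A, IsSet v ∧ ∀ z, z ∈ v ↔ z ∈ S then h.choose else default

/-- The (Kuratowski) ordered pair. -/
noncomputable def pair (a b : Obj.{u, w} A) : Obj.{u, w} A :=
  mkSet {mkSet {a}, mkSet {a, b}}

/-- Tuples; a tuple of length `1` is its only entry. -/
noncomputable def tuple : List (Obj.{u, w} A) → Obj.{u, w} A
  | [] => default
  | [a] => a
  | a :: l => pair a (tuple l)

/-- `f` is a function with `m` arguments: a single-valued set of ordered pairs whose domain is a
subset of `D ^ m` for some set `D`. -/
def IsFunction (m : ℕ) (f : Obj.{u, w} A) : Prop :=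
  IsSet f ∧
  (∃ D : Obj.{u, w} A, IsSet D ∧ ∀ p ∈ f, ∃ (a : Fin m → Obj.{u, w} A) (v : Obj.{u, w} A),
    (∀ j, a j ∈ D) ∧ p = pair (tuple (List.ofFn a)) v) ∧
  ∀ a v v' : Obj.{u, w} A, pair a v ∈ f → pair a v' ∈ f → v = v'

/-- `(a₁, …, a_m)` is a member of the domain of the function `f`. -/
def InDomain {m : ℕ} (f : Obj.{u, w} A) (a : Fin m → Obj.{u, w} A) : Prop :=
  ∃ v, pair (tuple (List.ofFn a)) v ∈ f

open Classical in
/-- The value `f(a₁, …, a_m)`. -/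
noncomputable def apply {m : ℕ} (f : Obj.{u, w} A) (a : Fin m → Obj.{u, w} A) : Obj.{u, w} A :=
  if h : InDomain f a then h.choose else default

end Obj

/-! ### Sequences of ordered pairs -/

/-- The domain `{a₁, …, a_m}` of `(a₁, b₁) ∥ … ∥ (a_m, b_m)`. -/
def dom {α β : Type*} (l : List (α × β)) : Set α := {a | ∃ p ∈ l, p.1 = a}

open Classical in
/-- The value `α(a)`, for `a` in the domain of `α`. -/
noncomputable def val {α β : Type*} [Inhabited β] (l : List (α × β)) (a : α) : β :=
  ((l.find? (fun p => decide (p.1 = a))).map Prod.snd).getD default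

open Classical in
/-- The restriction `α/B`: if no first component is repeated in `α` and `B` is the domain of an
initial segment of `α`, this is that initial segment. -/
noncomputable def restr {α β : Type*} (l : List (α × β)) (B : Set α) : List (α × β) :=
  l.takeWhile (fun p => decide (p.1 ∈ B))

/-! ### Strings -/

/-- The symbols: variables, constants, operators, the set builder `{}` and `( ) , :`. -/
inductive Symb (V C F : Type*)
  | var (x : V)
  | const (c : C)
  | op (f : F)
  | setb
  | lpar
  | rpar
  | comma
  | colon

/-- Strings of symbols. -/
abbrev Str (V C F : Type*) := List (Symb V C F)

/-- Sequences `(x₁, φ₁) ∥ … ∥ (x_p, φ_p)` of variables and strings. -/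
abbrev Ctx (V C F : Type*) := List (V × Str V C F)

/-- Sequences `(x₁, s₁) ∥ … ∥ (x_p, s_p)` of variables and objects. -/
abbrev State (V : Type*) (A : Type w) := List (V × Obj.{u, w} A)

section Strings

variable {V C F : Type*}

/-- The string `(ψ)(ψ₁, …, ψ_m)`. -/
def appStr {m : ℕ} (ψ : Str V C F) (ψs : Fin m → Str V C F) : Str V C F :=
  [Symb.lpar] ++ ψ ++ [Symb.rpar, Symb.lpar] ++ List.intercalate [Symb.comma] (List.ofFn ψs)
    ++ [Symb.rpar]

/-- The string `(f)(ψ₁, …, ψ_m)`. -/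
def opStr {m : ℕ} (f : F) (ψs : Fin m → Str V C F) : Str V C F := appStr [Symb.op f] ψs

/-- The string `{}(y₁ : ψ₁, …, y_m : ψ_m, ψ)`. -/
def setStr {m : ℕ} (y : Fin m → V) (ψs : Fin m → Str V C F) (ψ : Str V C F) : Str V C F :=
  [Symb.setb, Symb.lpar]
    ++ (List.ofFn fun j => [Symb.var (y j), Symb.colon] ++ ψs j ++ [Symb.comma]).flatten
    ++ ψ ++ [Symb.rpar]

/-- `k ∥ (y₁, ψ₁) ∥ … ∥ (y_j, ψ_j)`, where `j` runs from `0` to `m`. -/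
def extend {m : ℕ} (k : Ctx V C F) (y : Fin m → V) (ψs : Fin m → Str V C F) (j : ℕ) :
    Ctx V C F :=
  k ++ (List.ofFn fun a => (y a, ψs a)).take j

end Strings

/-! ### The language -/

/-- A language: variables `V`, constants `C` with a meaning, and operators `F`; an operator `f` comes
with the condition `A_f` on finite sequences of objects and with the value `P_f`, which matters only
where `A_f` holds. -/
structure Lang (V C F : Type*) (A : Type w) where
  meaning : C → Obj.{u, w} A
  app : F → List (Obj.{u, w} A) → Prop
  opVal : F → List (Obj.{u, w} A) → Obj.{u, w} A

/-- What is defined at one step of the construction: the contexts, the states of each context, the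
expressions of each context, their meanings, and the bound variables of an expression. -/
structure Stage (V C F : Type*) (A : Type w) where
  K : Set (Ctx V C F)
  Xi : Ctx V C F → Set (State.{u, w} V A)
  E : Ctx V C F → Set (Str V C F)
  den : Ctx V C F → Str V C F → State.{u, w} V A → Obj.{u, w} A
  Vb : Str V C F → Set V

namespace Stage

variable {V C F : Type*} {A : Type w} (S : Stage.{u, w} V C F A) (L : Lang.{u, w} V C F A)

/-- `h ∥ (y, φ)` is a context built from what is available at the step `S`. -/
structure CtxWF (h : Ctx V C F) (y : V) (φ : Str V C F) : Prop where
  ctx : h ∈ S.K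
  expr : φ ∈ S.E h
  fresh : y ∉ dom h
  isSet : ∀ ρ ∈ S.Xi h, (S.den h φ ρ).IsSet

/-- The conditions on `(ψ)(ψ₁, …, ψ_m)` with respect to the context `k`. -/
structure AppWF (k : Ctx V C F) {m : ℕ} (ψ : Str V C F) (ψs : Fin m → Str V C F) : Prop where
  ctx : k ∈ S.K
  pos : 0 < m
  head : ψ ∈ S.E k
  args : ∀ j, ψs j ∈ S.E k
  isFunction : ∀ σ ∈ S.Xi k, (S.den k ψ σ).IsFunction m
  inDomain : ∀ σ ∈ S.Xi k, (S.den k ψ σ).InDomain fun j => S.den k (ψs j) σ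

/-- The conditions on `(f)(ψ₁, …, ψ_m)` with respect to the context `k`. -/
structure OpWF (k : Ctx V C F) {m : ℕ} (f : F) (ψs : Fin m → Str V C F) : Prop where
  ctx : k ∈ S.K
  pos : 0 < m
  args : ∀ j, ψs j ∈ S.E k
  applicable : ∀ σ ∈ S.Xi k, L.app f (List.ofFn fun j => S.den k (ψs j) σ)

/-- The conditions on `{}(y₁ : ψ₁, …, y_m : ψ_m, ψ)` with respect to the context `k`. (Here `ψs j`,
for `j = 0, …, m - 1`, is an expression of `k ∥ (y₁, ψ₁) ∥ … ∥ (y_j, ψ_j)`.) -/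
structure SetWF (k : Ctx V C F) {m : ℕ} (y : Fin m → V) (ψs : Fin m → Str V C F)
    (ψ : Str V C F) : Prop where
  ctx : k ∈ S.K
  pos : 0 < m
  distinct : Function.Injective y
  fresh : ∀ j, y j ∉ dom k
  ctxs : ∀ j : Fin m, extend k y ψs j ∈ S.K
  exprs : ∀ j : Fin m, ψs j ∈ S.E (extend k y ψs j)
  isSet : ∀ j : Fin m, ∀ σ ∈ S.Xi (extend k y ψs j), (S.den (extend k y ψs j) (ψs j) σ).IsSet
  lastCtx : extend k y ψs m ∈ S.K
  body : ψ ∈ S.E (extend k y ψs m)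

/-- The new contexts. -/
def KPlus : Set (Ctx V C F) := {k | ∃ h y φ, S.CtxWF h y φ ∧ k = h ++ [(y, φ)]}

/-- Old expressions, in a context with one more variable. -/
def Ea (k : Ctx V C F) : Set (Str V C F) :=
  {t | ∃ h y φ, S.CtxWF h y φ ∧ k = h ++ [(y, φ)] ∧ t ∈ S.E h ∧ y ∉ S.Vb t}

/-- The last variable of a context. -/
def Eb (k : Ctx V C F) : Set (Str V C F) :=
  {t | ∃ h y φ, S.CtxWF h y φ ∧ k = h ++ [(y, φ)] ∧ t = [Symb.var y]}

/-- Application of functions. -/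
def Ec (k : Ctx V C F) : Set (Str V C F) :=
  {t | ∃ (m : ℕ) (ψ : Str V C F) (ψs : Fin m → Str V C F), S.AppWF k ψ ψs ∧ t = appStr ψ ψs}

/-- Application of operators. -/
def Ed (k : Ctx V C F) : Set (Str V C F) :=
  {t | ∃ (m : ℕ) (f : F) (ψs : Fin m → Str V C F), S.OpWF L k f ψs ∧ t = opStr f ψs}

/-- Set formation. -/
def Ee (k : Ctx V C F) : Set (Str V C F) :=
  {t | ∃ (m : ℕ) (y : Fin m → V) (ψs : Fin m → Str V C F) (ψ : Str V C F),
    S.SetWF k y ψs ψ ∧ t = setStr y ψs ψ}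

/-- `v` is a proposed value of `#(k, t, σ)` at the next step. -/
inductive NewDen (k : Ctx V C F) (t : Str V C F) (σ : State.{u, w} V A) : Obj.{u, w} A → Prop
  | a (h : Ctx V C F) (y : V) (φ : Str V C F) (ρ : State.{u, w} V A) (s : Obj.{u, w} A) :
      S.CtxWF h y φ → k = h ++ [(y, φ)] → t ∈ S.E h → y ∉ S.Vb t → σ = ρ ++ [(y, s)] →
      NewDen k t σ (S.den h t ρ)
  | b (h : Ctx V C F) (y : V) (φ : Str V C F) :
      S.CtxWF h y φ → k = h ++ [(y, φ)] → t = [Symb.var y] →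
      NewDen k t σ (val σ y)
  | c (m : ℕ) (ψ : Str V C F) (ψs : Fin m → Str V C F) :
      S.AppWF k ψ ψs → t = appStr ψ ψs →
      NewDen k t σ ((S.den k ψ σ).apply fun j => S.den k (ψs j) σ)
  | d (m : ℕ) (f : F) (ψs : Fin m → Str V C F) :
      S.OpWF L k f ψs → t = opStr f ψs →
      NewDen k t σ (L.opVal f (List.ofFn fun j => S.den k (ψs j) σ))
  | e (m : ℕ) (y : Fin m → V) (ψs : Fin m → Str V C F) (ψ : Str V C F) :
      S.SetWF k y ψs ψ → t = setStr y ψs ψ →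
      NewDen k t σ (Obj.mkSet {v | ∃ σ' ∈ S.Xi (extend k y ψs m),
        σ <+: σ' ∧ v = S.den (extend k y ψs m) ψ σ'})

/-- `B` is a proposed value of `V_b(t)` at the next step. -/
inductive NewVb (t : Str V C F) : Set V → Prop
  | a (h : Ctx V C F) (y : V) (φ : Str V C F) :
      S.CtxWF h y φ → t ∈ S.E h → y ∉ S.Vb t → NewVb t (S.Vb t)
  | b (h : Ctx V C F) (y : V) (φ : Str V C F) :
      S.CtxWF h y φ → t = [Symb.var y] → NewVb t ∅
  | c (k : Ctx V C F) (m : ℕ) (ψ : Str V C F) (ψs : Fin m → Str V C F) :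
      S.AppWF k ψ ψs → t = appStr ψ ψs → NewVb t (S.Vb ψ ∪ ⋃ j, S.Vb (ψs j))
  | d (k : Ctx V C F) (m : ℕ) (f : F) (ψs : Fin m → Str V C F) :
      S.OpWF L k f ψs → t = opStr f ψs → NewVb t (⋃ j, S.Vb (ψs j))
  | e (k : Ctx V C F) (m : ℕ) (y : Fin m → V) (ψs : Fin m → Str V C F) (ψ : Str V C F) :
      S.SetWF k y ψs ψ → t = setStr y ψs ψ →
      NewVb t (Set.range y ∪ (⋃ j, S.Vb (ψs j)) ∪ S.Vb ψ)

open Classical in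
/-- The next step of the construction. What has already been defined is kept; a new meaning, or a new
set of bound variables, is any of the proposed values. -/
noncomputable def next : Stage.{u, w} V C F A where
  K := S.K ∪ S.KPlus
  Xi k := {τ | (k ∈ S.K ∧ τ ∈ S.Xi k) ∨ (k ∉ S.K ∧ ∃ h y φ, S.CtxWF h y φ ∧ k = h ++ [(y, φ)] ∧
    ∃ σ ∈ S.Xi h, ∃ s ∈ S.den h φ σ, τ = σ ++ [(y, s)])}
  E k := {t | k ∈ S.K ∧ t ∈ S.E k} ∪ S.Ea k ∪ S.Eb k ∪ S.Ec k ∪ S.Ed L k ∪ S.Ee k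
  den k t σ :=
    if k ∈ S.K ∧ t ∈ S.E k then S.den k t σ
    else if h : ∃ v, S.NewDen L k t σ v then h.choose else default
  Vb t :=
    if ∃ k ∈ S.K, t ∈ S.E k then S.Vb t
    else if h : ∃ B, S.NewVb L t B then h.choose else ∅

end Stage

namespace Lang

variable {V C F : Type*} {A : Type w} (L : Lang.{u, w} V C F A)

/-- The first step: only the empty context, with the empty state and the constants. -/
noncomputable def first : Stage.{u, w} V C F A where
  K := {[]}
  Xi k := {σ | k = [] ∧ σ = []}
  E k := {t | k = [] ∧ ∃ c, t = [Symb.const c]}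
  den _ t _ := match t with
    | [Symb.const c] => L.meaning c
    | _ => default
  Vb _ := ∅

/-- The step `n` of the construction, for `n ≥ 1` (the index `0` is not used). -/
noncomputable def stage : ℕ → Stage.{u, w} V C F A
  | 0 => L.first
  | 1 => L.first
  | n + 2 => (stage (n + 1)).next L

/-- The set `K` of contexts. -/
def K : Set (Ctx V C F) := {k | ∃ n, 1 ≤ n ∧ k ∈ (L.stage n).K}

/-- The set `Ξ(k)` of states of the context `k`. -/
def Xi (k : Ctx V C F) : Set (State.{u, w} V A) :=
  {σ | ∃ n, 1 ≤ n ∧ k ∈ (L.stage n).K ∧ σ ∈ (L.stage n).Xi k}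

/-- The set `E(k)` of expressions with respect to the context `k`. -/
def E (k : Ctx V C F) : Set (Str V C F) :=
  {t | ∃ n, 1 ≤ n ∧ k ∈ (L.stage n).K ∧ t ∈ (L.stage n).E k}

/-- The meaning `#(k, t, σ)`, as defined at the first step at which `t` is an expression with respect
to `k`. -/
noncomputable def den (k : Ctx V C F) (t : Str V C F) (σ : State.{u, w} V A) : Obj.{u, w} A :=
  (L.stage (sInf {n | 1 ≤ n ∧ k ∈ (L.stage n).K ∧ t ∈ (L.stage n).E k})).den k t σ

/-- The bound variables `V_b(t)`, as defined at the first step at which `t` is an expression. -/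
noncomputable def Vb (t : Str V C F) : Set V :=
  (L.stage (sInf {n | 1 ≤ n ∧ ∃ k ∈ (L.stage n).K, t ∈ (L.stage n).E k})).Vb t

/-- For `k = (x₁, φ₁) ∥ … ∥ (x_p, φ_p)`, the situation `K(n; k; x₁, …, x_p; φ₁, …, φ_p)`; here
`k_{i-1}` is `k.take i` for the index `i : Fin p` counted from `0`. -/
structure Decomposition (n : ℕ) (k : Ctx V C F) : Prop where
  pos : 0 < k.length
  lt : k.length < n
  distinct : (k.map Prod.fst).Nodup
  ctx : ∀ i : Fin k.length, k.take i ∈ (L.stage (n - 1)).K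
  expr : ∀ i : Fin k.length, (k.get i).2 ∈ (L.stage (n - 1)).E (k.take i)
  isSet : ∀ i : Fin k.length, ∀ ρ ∈ L.Xi (k.take i), (L.den (k.take i) (k.get i).2 ρ).IsSet
  states : ∀ σ ∈ L.Xi k, ∃ s : Fin k.length → Obj.{u, w} A,
    σ = List.ofFn (fun i : Fin k.length => ((k.get i).1, s i)) ∧
    ∀ i : Fin k.length, s i ∈ L.den (k.take i) (k.get i).2 (restr σ (dom (k.take i)))

/-! ### Substitution -/

/-- The defining clauses of `φ_k{x/t}`: `L.SubExpr x t k φ φ'` means that one of them (there may be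
more than one that applies) yields `φ'` as a value of `φ_k{x/t}`. -/
inductive SubExpr (x : V) (t : Str V C F) : Ctx V C F → Str V C F → Str V C F → Prop
  /-- `φ` is an expression of the context that precedes the last variable, which is `x` -/
  | a_last (n : ℕ) (k h : Ctx V C F) (χ φ : Str V C F) :
      1 ≤ n → (L.stage n).CtxWF h x χ → k = h ++ [(x, χ)] →
      φ ∈ (L.stage n).E h → x ∉ (L.stage n).Vb φ →
      SubExpr x t k φ φ
  /-- `φ` is an expression of the context that precedes the last variable, which is not `x` -/
  | a_step (n : ℕ) (k h : Ctx V C F) (y : V) (χ φ φ' : Str V C F) :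
      1 ≤ n → (L.stage n).CtxWF h y χ → k = h ++ [(y, χ)] → x ∈ dom h →
      φ ∈ (L.stage n).E h → y ∉ (L.stage n).Vb φ → SubExpr x t h φ φ' →
      SubExpr x t k φ φ'
  /-- `φ` is the last variable of the context, which is `x` -/
  | b_last (n : ℕ) (k h : Ctx V C F) (χ : Str V C F) :
      1 ≤ n → (L.stage n).CtxWF h x χ → k = h ++ [(x, χ)] →
      SubExpr x t k [Symb.var x] t
  /-- `φ` is the last variable of the context, which is not `x` -/
  | b_step (n : ℕ) (k h : Ctx V C F) (y : V) (χ : Str V C F) :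
      1 ≤ n → (L.stage n).CtxWF h y χ → k = h ++ [(y, χ)] → x ∈ dom h →
      SubExpr x t k [Symb.var y] [Symb.var y]
  | c (n : ℕ) (k : Ctx V C F) (m : ℕ) (ψ ψ' : Str V C F) (ψs ψs' : Fin m → Str V C F) :
      1 ≤ n → (L.stage n).AppWF k ψ ψs →
      SubExpr x t k ψ ψ' → (∀ j, SubExpr x t k (ψs j) (ψs' j)) →
      SubExpr x t k (appStr ψ ψs) (appStr ψ' ψs')
  | d (n : ℕ) (k : Ctx V C F) (m : ℕ) (f : F) (ψs ψs' : Fin m → Str V C F) :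
      1 ≤ n → (L.stage n).OpWF L k f ψs →
      (∀ j, SubExpr x t k (ψs j) (ψs' j)) →
      SubExpr x t k (opStr f ψs) (opStr f ψs')
  | e (n : ℕ) (k : Ctx V C F) (m : ℕ) (y : Fin m → V) (ψs ψs' : Fin m → Str V C F)
      (ψ ψ' : Str V C F) :
      1 ≤ n → (L.stage n).SetWF k y ψs ψ →
      (∀ j : Fin m, SubExpr x t (extend k y ψs j) (ψs j) (ψs' j)) →
      SubExpr x t (extend k y ψs m) ψ ψ' →
      SubExpr x t k (setStr y ψs ψ) (setStr y ψs' ψ')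

/-- `φ_k{x/t}` is well defined: the clauses yield exactly one value. -/
def SubExprDefined (k : Ctx V C F) (x : V) (t φ : Str V C F) : Prop :=
  ∃! φ', L.SubExpr x t k φ φ'

open Classical in
/-- The expression `φ_k{x/t}` (when it is well defined). -/
noncomputable def subExpr (k : Ctx V C F) (x : V) (t φ : Str V C F) : Str V C F :=
  if h : ∃ φ', L.SubExpr x t k φ φ' then h.choose else φ

/-- The defining clauses of `k{x/t}`. -/
inductive SubCtx (x : V) (t : Str V C F) : Ctx V C F → Ctx V C F → Prop
  /-- `x` is the last variable of `k` -/
  | last (k h : Ctx V C F) (χ : Str V C F) :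
      k ∈ L.K → k = h ++ [(x, χ)] → SubCtx x t k h
  /-- `x` is not the last variable of `k` -/
  | step (k h h' : Ctx V C F) (y : V) (χ χ' : Str V C F) :
      k ∈ L.K → k = h ++ [(y, χ)] → x ∈ dom h →
      SubCtx x t h h' → L.SubExpr x t h χ χ' → SubCtx x t k (h' ++ [(y, χ')])

/-- `k{x/t}` is well defined: the clauses yield exactly one value. -/
def SubCtxDefined (k : Ctx V C F) (x : V) (t : Str V C F) : Prop :=
  ∃! k', L.SubCtx x t k k'

open Classical in
/-- The context `k{x/t}` (when it is well defined). -/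
noncomputable def subCtx (k : Ctx V C F) (x : V) (t : Str V C F) : Ctx V C F :=
  if h : ∃ k', L.SubCtx x t k k' then h.choose else k

open Classical in
/-- For `k = (x₁, φ₁) ∥ … ∥ (x_p, φ_p)`, `x = x_i` and `h = k_{i-1}`, the sequence
`σ = (x₁, r₁) ∥ … ∥ (x_p, r_p)` with `r_j = ρ(x_j)` for `j ≠ i` and `r_i = #(h, t, ρ/dom(h))`. -/
noncomputable def insertState (k h : Ctx V C F) (x : V) (t : Str V C F)
    (ρ : State.{u, w} V A) : State.{u, w} V A :=
  k.map fun p => (p.1, if p.1 = x then L.den h t (restr ρ (dom h)) else val ρ p.1)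

/-- The possible shapes of `φ` and `φ_k{x/t}`, at the step `n`. -/
inductive SubShape (n : ℕ) (k : Ctx V C F) (x : V) (t φ : Str V C F) : Prop
  | const (c : C) : φ = [Symb.const c] → L.subExpr k x t φ = φ → SubShape n k x t φ
  | var (z : V) : φ = [Symb.var z] → z ∈ dom k →
      (z = x → L.subExpr k x t φ = t) → (z ≠ x → L.subExpr k x t φ = φ) → SubShape n k x t φ
  | app (κ : Ctx V C F) (m : ℕ) (ψ : Str V C F) (ψs : Fin m → Str V C F) :
      κ <+: k → (L.stage (n - 1)).AppWF κ ψ ψs → φ = appStr ψ ψs → φ ∈ (L.stage n).E κ →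
      (x ∈ dom κ → L.SubExprDefined κ x t ψ ∧ (∀ j, L.SubExprDefined κ x t (ψs j)) ∧
        L.subExpr k x t φ = appStr (L.subExpr κ x t ψ) fun j => L.subExpr κ x t (ψs j)) →
      (x ∉ dom κ → L.subExpr k x t φ = φ) → SubShape n k x t φ
  | op (κ : Ctx V C F) (m : ℕ) (f : F) (ψs : Fin m → Str V C F) :
      κ <+: k → (L.stage (n - 1)).OpWF L κ f ψs → φ = opStr f ψs → φ ∈ (L.stage n).E κ →
      (x ∈ dom κ → (∀ j, L.SubExprDefined κ x t (ψs j)) ∧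
        L.subExpr k x t φ = opStr f fun j => L.subExpr κ x t (ψs j)) →
      (x ∉ dom κ → L.subExpr k x t φ = φ) → SubShape n k x t φ
  | set (κ : Ctx V C F) (m : ℕ) (y : Fin m → V) (ψs : Fin m → Str V C F) (ψ : Str V C F) :
      κ <+: k → (L.stage (n - 1)).SetWF κ y ψs ψ → φ = setStr y ψs ψ → φ ∈ (L.stage n).E κ →
      (x ∈ dom κ →
        (∀ j : Fin m, y j ∉ L.Vb t ∧ ψs j ∈ (L.stage n).E (extend κ y ψs j) ∧
          Disjoint (L.Vb t) (L.Vb (ψs j)) ∧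
          L.SubExprDefined (extend κ y ψs j) x t (ψs j)) ∧
        ψ ∈ (L.stage n).E (extend κ y ψs m) ∧ Disjoint (L.Vb t) (L.Vb ψ) ∧
        L.SubExprDefined (extend κ y ψs m) x t ψ ∧
        L.subExpr k x t φ = setStr y (fun j => L.subExpr (extend κ y ψs j) x t (ψs j))
          (L.subExpr (extend κ y ψs m) x t ψ)) →
      (x ∉ dom κ → L.subExpr k x t φ = φ) → SubShape n k x t φ

end Lang

end SubstLogic

open SubstLogic

namespace SubstLogic

/-! In the construction, the expressions, meanings, states and bound variables of one step depend on
those of the step before. One string may also arise by several clauses and in many contexts. This is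
harmless once strings are read as parse trees. An expression is the rendering of exactly one tree
(`Tree.readable`), and on trees the free variables, bound variables, replacement of a variable and
evaluation under a total assignment are plain structural recursions in which no context occurs.

The bridge is `Stage.Sound`, proved for every step by `Lang.sound`. Bound variables and meanings at
a step are those of the tree. The states of `k` are the assignments satisfying `Lang.Good k`, listed
along `k`. Free variables of an expression of `k` lie in `dom k`, and its bound variables lie
outside. So the choices made in the construction do not matter, and the semantic formation
conditions become conditions on assignments that do not mention the step.

Since `x` and the free variables of `t` lie in the domain of the context while the bound variables
of `φ` avoid it, replacing every leaf `x` by `t` neither hits a bound occurrence nor captures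
anything. The value of the result under `e` is the value of `φ` under `e` with `x` sent to the value
of `t` (`Tree.eval_subst`, `Lang.evalS_subS_of_expr`). Every value yielded by the substitution
clauses is this replacement (`Lang.subExpr_exists`, `Lang.SubExpr.eq_subS`). Hence substitution is
well defined and independent of the context.

What remains is that the replaced string is an expression of the replaced context
(`Lang.subst_mem`). This is where the conditions on the bound variables of `t` enter: expressions
containing `t` have to be carried past later variables by clause (a), which forbids those variables
to be bound in them. The semantic side conditions are transported by `Lang.good_update`, which also
shows that the state `σ_ρ` is a state of `k`. -/

/-! ### Parse trees -/

/-- Parse trees of strings. -/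
inductive Tree (V C F : Type*)
  | const (c : C) : Tree V C F
  | var (x : V) : Tree V C F
  | app (m : ℕ) (ψ : Tree V C F) (ψs : Fin m → Tree V C F) : Tree V C F
  | op (m : ℕ) (f : F) (ψs : Fin m → Tree V C F) : Tree V C F
  | set (m : ℕ) (y : Fin m → V) (ψs : Fin m → Tree V C F) (ψ : Tree V C F) : Tree V C F

namespace Tree

variable {V C F : Type*} {A : Type w}

/-- The string with a given parse tree. -/
def render : Tree V C F → Str V C F
  | const c => [Symb.const c]
  | var x => [Symb.var x]
  | app _ ψ ψs => appStr ψ.render fun j => (ψs j).render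
  | op _ f ψs => opStr f fun j => (ψs j).render
  | set _ y ψs ψ => setStr y (fun j => (ψs j).render) ψ.render

/-- The variables with an occurrence outside the scope of their binders. -/
def fv : Tree V C F → Set V
  | const _ => ∅
  | var x => {x}
  | app _ ψ ψs => ψ.fv ∪ ⋃ j, (ψs j).fv
  | op _ _ ψs => ⋃ j, (ψs j).fv
  | set _ y ψs ψ => ((⋃ j, (ψs j).fv) ∪ ψ.fv) \ Set.range y

/-- The bound variables. -/
def bv : Tree V C F → Set V
  | const _ => ∅
  | var _ => ∅
  | app _ ψ ψs => ψ.bv ∪ ⋃ j, (ψs j).bv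
  | op _ _ ψs => ⋃ j, (ψs j).bv
  | set _ y ψs ψ => Set.range y ∪ (⋃ j, (ψs j).bv) ∪ ψ.bv

open Classical in
/-- Replacement of all the leaves `x` by `U`. -/
noncomputable def subst (x : V) (U : Tree V C F) : Tree V C F → Tree V C F
  | const c => const c
  | var z => if z = x then U else var z
  | app m ψ ψs => app m (subst x U ψ) fun j => subst x U (ψs j)
  | op m f ψs => op m f fun j => subst x U (ψs j)
  | set m y ψs ψ => set m y (fun j => subst x U (ψs j)) (subst x U ψ)

/-- The meaning of a parse tree under an assignment of objects to the variables. The bound variables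
of a set builder are in scope in all of its parts. -/
noncomputable def eval (L : Lang.{u, w} V C F A) : Tree V C F → (V → Obj.{u, w} A) → Obj.{u, w} A
  | const c, _ => L.meaning c
  | var x, e => e x
  | app _ ψ ψs, e => (ψ.eval L e).apply fun j => (ψs j).eval L e
  | op _ f ψs, e => L.opVal f (List.ofFn fun j => (ψs j).eval L e)
  | set _ y ψs ψ, e => Obj.mkSet {v | ∃ e', (∀ z, z ∉ Set.range y → e' z = e z) ∧
      (∀ j, e' (y j) ∈ (ψs j).eval L e') ∧ v = ψ.eval L e'}

/-- The first symbol alone separates an empty argument list from a nonempty one, and `(f)(…)` from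
`(ψ)(…)`. -/
theorem render_eq_cons (T : Tree V C F) : ∃ s l, T.render = s :: l ∧ s ≠ Symb.rpar ∧
    s ≠ Symb.comma ∧ ∀ f, s ≠ Symb.op f := by
  cases T <;> simp [render, appStr, opStr, setStr]

/-- The tree can be read off from every string that begins with its rendering. -/
def Readable (T : Tree V C F) : Prop :=
  ∀ (T' : Tree V C F) (r r' : Str V C F), T.render ++ r = T'.render ++ r' → T = T' ∧ r = r'

/-- Once an argument has been read off on both sides, the next symbol is a comma or a closing
parenthesis, the same on both sides. So the two lists end together. -/
theorem args_readable (l : List (Tree V C F)) (hl : ∀ T ∈ l, T.Readable) :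
    ∀ (l' : List (Tree V C F)) (r r' : Str V C F),
      List.intercalate [Symb.comma] (l.map render) ++ Symb.rpar :: r =
        List.intercalate [Symb.comma] (l'.map render) ++ Symb.rpar :: r' → l = l' ∧ r = r' := by
  induction l with
  | nil =>
    intro l' r r' h
    rcases l' with _ | ⟨T', _ | ⟨T'', l'⟩⟩
    · simpa using h
    all_goals
      obtain ⟨s, q, hs, h1, -⟩ := render_eq_cons T'
      simp [List.intercalate, hs, Ne.symm h1] at h
  | cons T l ih =>
    intro l' r r' h
    have hT := hl T (by simp)
    have ih := ih fun T hT => hl T (by simp [hT])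
    rcases l' with _ | ⟨T', l'⟩
    · obtain ⟨s, q, hs, h1, -⟩ := render_eq_cons T
      cases l <;> simp [List.intercalate, hs, h1] at h
    · rcases l with _ | ⟨T₁, l⟩ <;> rcases l' with _ | ⟨T₁', l'⟩
      · have := hT T' (Symb.rpar :: r) (Symb.rpar :: r') (by simpa using h)
        simpa using this
      · have := hT T' (Symb.rpar :: r) _ (by simpa [List.intercalate] using h)
        simp at this
      · have := hT T' _ (Symb.rpar :: r') (by simpa [List.intercalate] using h)
        simp at this
      · have := hT T' (Symb.comma :: (List.intercalate [Symb.comma] ((T₁ :: l).map render) ++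
            Symb.rpar :: r)) (Symb.comma :: (List.intercalate [Symb.comma] ((T₁' :: l').map render)
            ++ Symb.rpar :: r')) (by simpa [List.intercalate] using h)
        obtain ⟨h1, h2⟩ := this
        have := ih (T₁' :: l') r r' (List.cons.inj h2).2
        simp [h1, this]

/-- A binder and the body may both begin with a variable. The next symbol tells them apart: a colon
after the variable of a binder, and a closing parenthesis after a body that begins with a variable,
since such a body is that variable alone. -/
theorem binders_readable (l : List (V × Tree V C F)) (hl : ∀ p ∈ l, p.2.Readable)
    (ψ : Tree V C F) (hψ : ψ.Readable) :
    ∀ (l' : List (V × Tree V C F)) (ψ' : Tree V C F) (r r' : Str V C F),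
      (l.map fun p => [Symb.var p.1, Symb.colon] ++ p.2.render ++ [Symb.comma]).flatten ++
          (ψ.render ++ Symb.rpar :: r) =
        (l'.map fun p => [Symb.var p.1, Symb.colon] ++ p.2.render ++ [Symb.comma]).flatten ++
          (ψ'.render ++ Symb.rpar :: r') → l = l' ∧ ψ = ψ' ∧ r = r' := by
  induction l with
  | nil =>
    intro l' ψ' r r' h
    rcases l' with _ | ⟨p, l'⟩
    · have := hψ ψ' _ _ (by simpa using h)
      simpa using this
    · have := hψ (var p.1) (Symb.rpar :: r) (Symb.colon :: (p.2.render ++ [Symb.comma] ++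
        (l'.map fun p => [Symb.var p.1, Symb.colon] ++ p.2.render ++ [Symb.comma]).flatten ++
          (ψ'.render ++ Symb.rpar :: r'))) (by simpa [render] using h)
      simp at this
  | cons p l ih =>
    intro l' ψ' r r' h
    have hp := hl p (by simp)
    have ih := ih fun q hq => hl q (by simp [hq])
    rcases l' with _ | ⟨p', l'⟩
    · exfalso
      cases ψ' <;> simp [render, appStr, opStr, setStr] at h
    · simp only [List.map_cons, List.flatten_cons, List.append_assoc, List.cons_append,
        List.nil_append, List.cons.injEq, Symb.var.injEq, true_and] at h
      obtain ⟨h1, h2⟩ := h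
      obtain ⟨h3, h4⟩ := hp _ _ _ h2
      obtain ⟨h5, h6⟩ := ih l' ψ' r r' (by simpa using h4)
      exact ⟨by rw [h5, Prod.ext h1 h3], h6⟩

/-- The arbitrary tails in `Readable` carry the induction: inside a term, each subterm is followed
by further symbols, and its end has to be found. -/
theorem readable (T : Tree V C F) : T.Readable := by
  induction T with
  | const c =>
    intro T' r r' h
    cases T' <;> simp [render, appStr, opStr, setStr] at h ⊢
    exact h
  | var x =>
    intro T' r r' h
    cases T' <;> simp [render, appStr, opStr, setStr] at h ⊢
    exact h
  | app m ψ ψs ihψ ih =>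
    intro T' r r' h
    cases T' with
    | const c => simp [render, appStr] at h
    | var c => simp [render, appStr] at h
    | set m' y φs φ => simp [render, appStr, setStr] at h
    | op m' f φs =>
      obtain ⟨s, l, hs, -, -, h3⟩ := render_eq_cons ψ
      simp [render, appStr, opStr, hs, h3] at h
    | app m' φ φs =>
      simp only [render, appStr, List.append_assoc, List.cons_append, List.nil_append,
        List.cons.injEq, true_and] at h
      obtain ⟨h1, h2⟩ := ihψ _ _ _ h
      simp only [List.cons.injEq, true_and] at h2
      obtain ⟨h3, h4⟩ := args_readable (List.ofFn ψs)
        (fun T hT => by obtain ⟨j, rfl⟩ := (List.mem_ofFn' _ _).1 hT; exact ih j) (List.ofFn φs) r r'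
        (by simpa [List.map_ofFn, Function.comp_def] using h2)
      have := List.ofFn_inj'.1 h3
      simp only [Sigma.mk.injEq] at this
      obtain ⟨rfl, h5⟩ := this
      simp [h1, h4, eq_of_heq h5]
  | op m f ψs ih =>
    intro T' r r' h
    cases T' with
    | const c => simp [render, appStr, opStr] at h
    | var c => simp [render, appStr, opStr] at h
    | set m' y φs φ => simp [render, appStr, opStr, setStr] at h
    | app m' φ φs =>
      obtain ⟨s, l, hs, -, -, h3⟩ := render_eq_cons φ
      simp [render, appStr, opStr, hs, (h3 _).symm] at h
    | op m' f' φs =>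
      simp only [render, appStr, opStr, List.append_assoc, List.cons_append, List.nil_append,
        List.cons.injEq, true_and, Symb.op.injEq] at h
      obtain ⟨h1, h2⟩ := h
      obtain ⟨h3, h4⟩ := args_readable (List.ofFn ψs)
        (fun T hT => by obtain ⟨j, rfl⟩ := (List.mem_ofFn' _ _).1 hT; exact ih j) (List.ofFn φs) r r'
        (by simpa [List.map_ofFn, Function.comp_def] using h2)
      have := List.ofFn_inj'.1 h3
      simp only [Sigma.mk.injEq] at this
      obtain ⟨rfl, h5⟩ := this
      simp [h1, h4, eq_of_heq h5]
  | set m y ψs ψ ih ihψ =>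
    intro T' r r' h
    cases T' with
    | const c => simp [render, setStr] at h
    | var c => simp [render, setStr] at h
    | app m' φ φs => simp [render, appStr, setStr] at h
    | op m' f φs => simp [render, appStr, opStr, setStr] at h
    | set m' y' φs φ =>
      simp only [render, setStr, List.append_assoc, List.cons_append, List.nil_append,
        List.cons.injEq, true_and] at h
      obtain ⟨h3, h4, h6⟩ := binders_readable (List.ofFn fun j => (y j, ψs j))
        (fun T hT => by obtain ⟨j, rfl⟩ := (List.mem_ofFn' _ _).1 hT; exact ih j) ψ ihψ
        (List.ofFn fun j => (y' j, φs j)) φ r r'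
        (by simpa [List.map_ofFn, Function.comp_def] using h)
      have := List.ofFn_inj'.1 h3
      simp only [Sigma.mk.injEq] at this
      obtain ⟨rfl, h5⟩ := this
      have h5 := eq_of_heq h5
      have h7 : y = y' := funext fun j => congrArg Prod.fst (congrFun h5 j)
      have h8 : ψs = φs := funext fun j => congrArg Prod.snd (congrFun h5 j)
      simp [h4, h6, h7, h8]

theorem render_injective : Function.Injective (render : Tree V C F → Str V C F) :=
  fun T T' h => (readable T T' [] [] (by simpa using h)).1

/-! ### Evaluation and replacement on trees -/

theorem eval_congr (L : Lang.{u, w} V C F A) (T : Tree V C F) :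
    ∀ {e e' : V → Obj.{u, w} A}, Set.EqOn e e' T.fv → T.eval L e = T.eval L e' := by
  induction T with
  | const c => intros; rfl
  | var x => intro e e' h; exact h rfl
  | app m ψ ψs ihψ ih =>
    intro e e' h
    simp only [eval]
    rw [ihψ (h.mono (by simp [fv]))]
    congr 1
    funext j
    exact ih j (h.mono fun z hz => Or.inr (Set.mem_iUnion.2 ⟨j, hz⟩))
  | op m f ψs ih =>
    intro e e' h
    simp only [eval]
    congr 2
    funext j
    exact ih j (h.mono fun z hz => Set.mem_iUnion.2 ⟨j, hz⟩)
  | set m y ψs ψ ih ihψ =>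
    -- One inclusion is enough, as the hypothesis is symmetric in the two assignments.
    have key : ∀ {e e' : V → Obj.{u, w} A}, Set.EqOn e e' (set m y ψs ψ).fv →
        {v | ∃ d, (∀ z, z ∉ Set.range y → d z = e z) ∧
          (∀ j, d (y j) ∈ (ψs j).eval L d) ∧ v = ψ.eval L d} ⊆
        {v | ∃ d, (∀ z, z ∉ Set.range y → d z = e' z) ∧
          (∀ j, d (y j) ∈ (ψs j).eval L d) ∧ v = ψ.eval L d} := by
      classical
      rintro e e' h _ ⟨d, h1, h2, rfl⟩
      -- The witness for `e'` keeps the values of `d` on the binders and follows `e'` elsewhere; the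
      -- parts of the set builder cannot see the difference.
      have h3 : Set.EqOn d (fun z => if z ∈ Set.range y then d z else e' z)
          ((⋃ j, (ψs j).fv) ∪ ψ.fv) := by
        intro z hz
        by_cases hy : z ∈ Set.range y
        · simp only [hy, if_true]
        · simp only [hy, if_false]
          exact (h1 z hy).trans (h ⟨hz, hy⟩)
      refine ⟨fun z => if z ∈ Set.range y then d z else e' z, fun z hz => by simp only [hz, if_false],
        fun j => ?_, ihψ (h3.mono Set.subset_union_right)⟩
      rw [← ih j (h3.mono fun z hz => Or.inl (Set.mem_iUnion.2 ⟨j, hz⟩))]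
      simpa using h2 j
    intro e e' h
    exact congrArg Obj.mkSet ((key h).antisymm (key h.symm))

/-- Absence from `fv` does not suffice, because `subst` also replaces leaves inside the scope of a
binder `x`. -/
theorem subst_eq_self (x : V) (U T : Tree V C F) (h : x ∉ T.fv) (h' : x ∉ T.bv) :
    subst x U T = T := by
  induction T with
  | const c => rfl
  | var z => exact if_neg fun hz => h hz.symm
  | app m ψ ψs ihψ ih =>
    simp only [fv, bv, Set.mem_union, Set.mem_iUnion, not_or, not_exists] at h h'
    simp only [subst, ihψ h.1 h'.1, fun j => ih j (h.2 j) (h'.2 j)]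
  | op m f ψs ih =>
    simp only [fv, bv, Set.mem_iUnion, not_exists] at h h'
    simp only [subst, fun j => ih j (h j) (h' j)]
  | set m y ψs ψ ih ihψ =>
    simp only [bv, Set.mem_union, Set.mem_iUnion, not_or, not_exists] at h'
    simp only [fv, Set.mem_sdiff, h'.1.1, not_false_eq_true, and_true, Set.mem_union,
      Set.mem_iUnion, not_or, not_exists] at h
    simp only [subst, ihψ h.2 h'.2, fun j => ih j (h.1 j) (h'.1.2 j)]

theorem bv_subst (x : V) (U T : Tree V C F) : (subst x U T).bv ⊆ T.bv ∪ U.bv := by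
  induction T with
  | const c => simp [subst, bv]
  | var z => by_cases h : z = x <;> simp [subst, bv, h]
  | app m ψ ψs ihψ ih =>
    simp only [subst, bv, Set.union_subset_iff, Set.iUnion_subset_iff]
    refine ⟨ihψ.trans (by grind), fun j => (ih j).trans ?_⟩
    have := Set.subset_iUnion (fun j => (ψs j).bv) j
    grind
  | op m f ψs ih =>
    simp only [subst, bv, Set.iUnion_subset_iff]
    intro j
    have := Set.subset_iUnion (fun j => (ψs j).bv) j
    exact (ih j).trans (by grind)
  | set m y ψs ψ ih ihψ =>
    simp only [subst, bv, Set.union_subset_iff, Set.iUnion_subset_iff]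
    refine ⟨⟨by grind, fun j => (ih j).trans ?_⟩, ihψ.trans (by grind)⟩
    have := Set.subset_iUnion (fun j => (ψs j).bv) j
    grind

-- The hypothesis `hU` excludes capture: the value of `U` stays the same while bound variables vary.
-- By `hx`, no binder overrides the value given to `x`, so the update at `x` is compatible with the
-- choice of values for the binders.
open Classical in
theorem eval_subst (L : Lang.{u, w} V C F A) (x : V) (U T : Tree V C F)
    (hU : Disjoint T.bv U.fv) (hx : x ∉ T.bv) :
    ∀ e : V → Obj.{u, w} A,
      (subst x U T).eval L e = T.eval L (Function.update e x (U.eval L e)) := by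
  induction T with
  | const c => intro e; rfl
  | var z =>
    intro e
    by_cases h : z = x
    · subst h; simp [subst, eval]
    · simp [subst, eval, h]
  | app m ψ ψs ihψ ih =>
    intro e
    simp only [bv, Set.mem_union, Set.mem_iUnion, not_or, not_exists, Set.disjoint_union_left,
      Set.disjoint_iUnion_left] at hU hx
    simp only [subst, eval, ihψ hU.1 hx.1, fun j => ih j (hU.2 j) (hx.2 j)]
  | op m f ψs ih =>
    intro e
    simp only [bv, Set.mem_iUnion, not_exists, Set.disjoint_iUnion_left] at hU hx
    simp only [subst, eval, fun j => ih j (hU j) (hx j)]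
  | set m y ψs ψ ih ihψ =>
    intro e
    simp only [bv, Set.mem_union, Set.mem_iUnion, not_or, not_exists, Set.disjoint_union_left,
      Set.disjoint_iUnion_left] at hU hx
    simp only [subst, eval, ihψ hU.2 hx.2, fun j => ih j (hU.1.2 j) (hx.1.2 j)]
    have hy : ∀ j, y j ≠ x := fun j hj => hx.1.1 ⟨j, hj⟩
    have hfv : ∀ d : V → Obj.{u, w} A, (∀ z, z ∉ Set.range y → d z = e z) →
        U.eval L d = U.eval L e :=
      fun d hd => eval_congr L U fun z hz => hd z fun h => Set.disjoint_left.1 hU.1.1 h hz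
    refine congrArg Obj.mkSet (Set.ext fun v => ?_)
    constructor
    · rintro ⟨d, h1, h2, rfl⟩
      have h3 := hfv d h1
      rw [h3]
      refine ⟨_, fun z hz => ?_, fun j => ?_, rfl⟩
      · by_cases hzx : z = x
        · simp [hzx]
        · simp [hzx, h1 z hz]
      · have := h2 j
        rw [h3] at this
        simpa [hy j] using this
    · rintro ⟨d, h1, h2, rfl⟩
      -- As `x` is not a binder, `d x` is the value of `U`. Resetting it to `e x` gives the witness
      -- for the substituted side, and updating again restores `d`.
      have h0 : ∀ z, z ∉ Set.range y → Function.update d x (e x) z = e z := by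
        intro z hz
        by_cases hzx : z = x
        · simp [hzx]
        · simpa [hzx] using h1 z hz
      have h4 : Function.update (Function.update d x (e x)) x (U.eval L e) = d := by
        have := h1 x hx.1.1
        simp only [Function.update_self] at this
        simp [← this]
      refine ⟨Function.update d x (e x), h0, fun j => ?_, ?_⟩
      · rw [hfv _ h0, h4]
        simpa [hy j] using h2 j
      · rw [hfv _ h0, h4]

end Tree
-- Transfer of the tree operations to strings
section Terms

variable {V C F : Type*} {A : Type w} (L : Lang.{u, w} V C F A)

/-- The string has a parse tree. -/
def IsTerm (t : Str V C F) : Prop := ∃ T : Tree V C F, T.render = t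

open Classical in
/-- The extension to strings of a function of parse trees. -/
noncomputable def onTree {β : Type*} (d : β) (g : Tree V C F → β) (t : Str V C F) : β :=
  if h : ∃ T : Tree V C F, T.render = t then g h.choose else d

@[simp] theorem onTree_render {β : Type*} (d : β) (g : Tree V C F → β) (T : Tree V C F) :
    onTree d g T.render = g T := by
  have h : ∃ T' : Tree V C F, T'.render = T.render := ⟨T, rfl⟩
  rw [onTree, dif_pos h, Tree.render_injective h.choose_spec]

/-- The free variables of a string. -/
noncomputable def fvS (t : Str V C F) : Set V := onTree ∅ Tree.fv t

/-- The bound variables of a string. -/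
noncomputable def bvS (t : Str V C F) : Set V := onTree ∅ Tree.bv t

/-- The result of the replacement of the variable `x` by `t` in a string. -/
noncomputable def subS (x : V) (t φ : Str V C F) : Str V C F :=
  onTree φ (fun U => onTree φ (fun T => (Tree.subst x U T).render) φ) t

/-- The meaning of a string under an assignment. -/
noncomputable def Lang.evalS (t : Str V C F) (e : V → Obj.{u, w} A) : Obj.{u, w} A :=
  onTree default (fun T => T.eval L e) t

@[simp] theorem fvS_render (T : Tree V C F) : fvS T.render = T.fv := onTree_render _ _ T

@[simp] theorem bvS_render (T : Tree V C F) : bvS T.render = T.bv := onTree_render _ _ T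

@[simp] theorem subS_render (x : V) (U T : Tree V C F) :
    subS x U.render T.render = (Tree.subst x U T).render := by simp [subS]

@[simp] theorem Lang.evalS_render (T : Tree V C F) (e : V → Obj.{u, w} A) :
    L.evalS T.render e = T.eval L e := onTree_render _ _ T

theorem isTerm_const (c : C) : IsTerm ([Symb.const c] : Str V C F) := ⟨Tree.const c, rfl⟩

theorem isTerm_var (x : V) : IsTerm ([Symb.var x] : Str V C F) := ⟨Tree.var x, rfl⟩

section

variable {m : ℕ} {ψ : Str V C F} {ψs : Fin m → Str V C F}

theorem exists_trees (hs : ∀ j, IsTerm (ψs j)) :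
    ∃ Ts : Fin m → Tree V C F, ψs = fun j => (Ts j).render := by
  choose Ts h using hs
  exact ⟨Ts, funext fun j => (h j).symm⟩

theorem isTerm_app (h : IsTerm ψ) (hs : ∀ j, IsTerm (ψs j)) : IsTerm (appStr ψ ψs) := by
  obtain ⟨T, rfl⟩ := h
  obtain ⟨Ts, rfl⟩ := exists_trees hs
  exact ⟨Tree.app m T Ts, rfl⟩

theorem isTerm_op (f : F) (hs : ∀ j, IsTerm (ψs j)) : IsTerm (opStr f ψs) := by
  obtain ⟨Ts, rfl⟩ := exists_trees hs
  exact ⟨Tree.op m f Ts, rfl⟩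

theorem isTerm_set (y : Fin m → V) (h : IsTerm ψ) (hs : ∀ j, IsTerm (ψs j)) :
    IsTerm (setStr y ψs ψ) := by
  obtain ⟨T, rfl⟩ := h
  obtain ⟨Ts, rfl⟩ := exists_trees hs
  exact ⟨Tree.set m y Ts T, rfl⟩

theorem fvS_const (c : C) : fvS ([Symb.const c] : Str V C F) = ∅ :=
  fvS_render (Tree.const c)

theorem fvS_var (x : V) : fvS ([Symb.var x] : Str V C F) = {x} :=
  fvS_render (Tree.var x)

theorem fvS_app (h : IsTerm ψ) (hs : ∀ j, IsTerm (ψs j)) :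
    fvS (appStr ψ ψs) = fvS ψ ∪ ⋃ j, fvS (ψs j) := by
  obtain ⟨T, rfl⟩ := h
  obtain ⟨Ts, rfl⟩ := exists_trees hs
  simp only [fvS_render]
  exact fvS_render (Tree.app m T Ts)

theorem fvS_op (f : F) (hs : ∀ j, IsTerm (ψs j)) :
    fvS (opStr f ψs) = ⋃ j, fvS (ψs j) := by
  obtain ⟨Ts, rfl⟩ := exists_trees hs
  simp only [fvS_render]
  exact fvS_render (Tree.op m f Ts)

theorem fvS_set (y : Fin m → V) (h : IsTerm ψ) (hs : ∀ j, IsTerm (ψs j)) :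
    fvS (setStr y ψs ψ) = ((⋃ j, fvS (ψs j)) ∪ fvS ψ) \ Set.range y := by
  obtain ⟨T, rfl⟩ := h
  obtain ⟨Ts, rfl⟩ := exists_trees hs
  simp only [fvS_render]
  exact fvS_render (Tree.set m y Ts T)

theorem bvS_const (c : C) : bvS ([Symb.const c] : Str V C F) = ∅ :=
  bvS_render (Tree.const c)

theorem bvS_var (x : V) : bvS ([Symb.var x] : Str V C F) = ∅ :=
  bvS_render (Tree.var x)

theorem bvS_app (h : IsTerm ψ) (hs : ∀ j, IsTerm (ψs j)) :
    bvS (appStr ψ ψs) = bvS ψ ∪ ⋃ j, bvS (ψs j) := by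
  obtain ⟨T, rfl⟩ := h
  obtain ⟨Ts, rfl⟩ := exists_trees hs
  simp only [bvS_render]
  exact bvS_render (Tree.app m T Ts)

theorem bvS_op (f : F) (hs : ∀ j, IsTerm (ψs j)) :
    bvS (opStr f ψs) = ⋃ j, bvS (ψs j) := by
  obtain ⟨Ts, rfl⟩ := exists_trees hs
  simp only [bvS_render]
  exact bvS_render (Tree.op m f Ts)

theorem bvS_set (y : Fin m → V) (h : IsTerm ψ) (hs : ∀ j, IsTerm (ψs j)) :
    bvS (setStr y ψs ψ) = Set.range y ∪ (⋃ j, bvS (ψs j)) ∪ bvS ψ := by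
  obtain ⟨T, rfl⟩ := h
  obtain ⟨Ts, rfl⟩ := exists_trees hs
  simp only [bvS_render]
  exact bvS_render (Tree.set m y Ts T)

theorem subS_const (x : V) {t : Str V C F} (ht : IsTerm t) (c : C) :
    subS x t [Symb.const c] = [Symb.const c] := by
  obtain ⟨U, rfl⟩ := ht
  exact subS_render x U (Tree.const c)

theorem subS_var_self (x : V) {t : Str V C F} (ht : IsTerm t) : subS x t [Symb.var x] = t := by
  obtain ⟨U, rfl⟩ := ht
  exact (subS_render x U (Tree.var x)).trans (by simp [Tree.subst])

theorem subS_var_of_ne (x : V) {t : Str V C F} (ht : IsTerm t) {z : V} (hz : z ≠ x) :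
    subS x t [Symb.var z] = [Symb.var z] := by
  obtain ⟨U, rfl⟩ := ht
  exact (subS_render x U (Tree.var z)).trans (by simp [Tree.subst, hz, Tree.render])

theorem subS_app (x : V) {t : Str V C F} (ht : IsTerm t) (h : IsTerm ψ)
    (hs : ∀ j, IsTerm (ψs j)) :
    subS x t (appStr ψ ψs) = appStr (subS x t ψ) fun j => subS x t (ψs j) := by
  obtain ⟨U, rfl⟩ := ht
  obtain ⟨T, rfl⟩ := h
  obtain ⟨Ts, rfl⟩ := exists_trees hs
  simp only [subS_render]
  exact subS_render x U (Tree.app m T Ts)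

theorem subS_op (x : V) {t : Str V C F} (ht : IsTerm t) (f : F)
    (hs : ∀ j, IsTerm (ψs j)) :
    subS x t (opStr f ψs) = opStr f fun j => subS x t (ψs j) := by
  obtain ⟨U, rfl⟩ := ht
  obtain ⟨Ts, rfl⟩ := exists_trees hs
  simp only [subS_render]
  exact subS_render x U (Tree.op m f Ts)

theorem subS_set (x : V) {t : Str V C F} (ht : IsTerm t) (y : Fin m → V) (h : IsTerm ψ)
    (hs : ∀ j, IsTerm (ψs j)) :
    subS x t (setStr y ψs ψ) = setStr y (fun j => subS x t (ψs j)) (subS x t ψ) := by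
  obtain ⟨U, rfl⟩ := ht
  obtain ⟨T, rfl⟩ := h
  obtain ⟨Ts, rfl⟩ := exists_trees hs
  simp only [subS_render]
  exact subS_render x U (Tree.set m y Ts T)

namespace Lang

theorem evalS_const (c : C) (e : V → Obj.{u, w} A) :
    L.evalS [Symb.const c] e = L.meaning c :=
  L.evalS_render (Tree.const c) e

theorem evalS_var (x : V) (e : V → Obj.{u, w} A) : L.evalS [Symb.var x] e = e x :=
  L.evalS_render (Tree.var x) e

theorem evalS_app (h : IsTerm ψ) (hs : ∀ j, IsTerm (ψs j)) (e : V → Obj.{u, w} A) :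
    L.evalS (appStr ψ ψs) e = (L.evalS ψ e).apply fun j => L.evalS (ψs j) e := by
  obtain ⟨T, rfl⟩ := h
  obtain ⟨Ts, rfl⟩ := exists_trees hs
  simp only [evalS_render]
  exact L.evalS_render (Tree.app m T Ts) e

theorem evalS_op (f : F) (hs : ∀ j, IsTerm (ψs j)) (e : V → Obj.{u, w} A) :
    L.evalS (opStr f ψs) e = L.opVal f (List.ofFn fun j => L.evalS (ψs j) e) := by
  obtain ⟨Ts, rfl⟩ := exists_trees hs
  simp only [evalS_render]
  exact L.evalS_render (Tree.op m f Ts) e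

theorem evalS_set (y : Fin m → V) (h : IsTerm ψ) (hs : ∀ j, IsTerm (ψs j))
    (e : V → Obj.{u, w} A) :
    L.evalS (setStr y ψs ψ) e = Obj.mkSet {v | ∃ e', (∀ z, z ∉ Set.range y → e' z = e z) ∧
      (∀ j, e' (y j) ∈ L.evalS (ψs j) e') ∧ v = L.evalS ψ e'} := by
  obtain ⟨T, rfl⟩ := h
  obtain ⟨Ts, rfl⟩ := exists_trees hs
  simp only [evalS_render]
  exact L.evalS_render (Tree.set m y Ts T) e

theorem evalS_congr (t : Str V C F) {e e' : V → Obj.{u, w} A}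
    (h : Set.EqOn e e' (fvS t)) : L.evalS t e = L.evalS t e' := by
  by_cases ht : IsTerm t
  · obtain ⟨T, rfl⟩ := ht
    simp only [fvS_render] at h
    simpa using Tree.eval_congr L T h
  · have h0 : ∀ e, L.evalS t e = default := fun e => dif_neg ht
    rw [h0, h0]

open Classical in
theorem evalS_subS (x : V) {t φ : Str V C F} (ht : IsTerm t) (hφ : IsTerm φ)
    (hd : Disjoint (bvS φ) (fvS t)) (hx : x ∉ bvS φ) (e : V → Obj.{u, w} A) :
    L.evalS (subS x t φ) e = L.evalS φ (Function.update e x (L.evalS t e)) := by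
  obtain ⟨U, rfl⟩ := ht
  obtain ⟨T, rfl⟩ := hφ
  simp only [bvS_render, fvS_render] at hd hx
  simpa using Tree.eval_subst L x U T hd hx e

end Lang

/-- No string has to be a term here, because the default value in `subS` is `φ` itself. -/
theorem subS_eq_self {x : V} {t φ : Str V C F} (hf : x ∉ fvS φ) (hb : x ∉ bvS φ) :
    subS x t φ = φ := by
  by_cases ht : IsTerm t
  · obtain ⟨U, rfl⟩ := ht
    by_cases hφ : IsTerm φ
    · obtain ⟨T, rfl⟩ := hφ
      simp only [bvS_render, fvS_render] at hf hb
      simp [Tree.subst_eq_self x U T hf hb]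
    · simp only [subS, onTree_render]
      exact dif_neg hφ
  · exact dif_neg ht

theorem bvS_subS (x : V) {t φ : Str V C F} (ht : IsTerm t) (hφ : IsTerm φ) :
    bvS (subS x t φ) ⊆ bvS φ ∪ bvS t := by
  obtain ⟨U, rfl⟩ := ht
  obtain ⟨T, rfl⟩ := hφ
  simpa using Tree.bv_subst x U T

end

end Terms

/-! ### Domains, states and assignments -/

section Domains

variable {V C F : Type*} {A : Type w} (L : Lang.{u, w} V C F A)

@[simp] theorem dom_nil {α β : Type*} : dom ([] : List (α × β)) = ∅ := by simp [dom]

@[simp] theorem dom_append {α β : Type*} (l l' : List (α × β)) :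
    dom (l ++ l') = dom l ∪ dom l' := by
  ext a
  simp [dom, or_and_right, exists_or]

@[simp] theorem dom_cons {α β : Type*} (p : α × β) (l : List (α × β)) :
    dom (p :: l) = insert p.1 (dom l) := by
  ext a
  simp [dom, eq_comm]

theorem fst_mem_dom {α β : Type*} {p : α × β} {l : List (α × β)} (h : p ∈ l) : p.1 ∈ dom l :=
  ⟨p, h, rfl⟩

/-- The state of the context `k` which is given by an assignment. -/
def mkState (k : Ctx V C F) (e : V → Obj.{u, w} A) : State.{u, w} V A :=
  k.map fun p => (p.1, e p.1)

theorem mkState_append (k k' : Ctx V C F) (e : V → Obj.{u, w} A) :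
    mkState (k ++ k') e = mkState k e ++ mkState k' e := List.map_append

theorem mkState_congr {k : Ctx V C F} {e e' : V → Obj.{u, w} A} (h : Set.EqOn e e' (dom k)) :
    mkState k e = mkState k e' :=
  List.map_congr_left fun p hp => by rw [h (fst_mem_dom hp)]

theorem val_mkState {k : Ctx V C F} (e : V → Obj.{u, w} A) {z : V} (hz : z ∈ dom k) :
    val (mkState k e) z = e z := by
  induction k with
  | nil => simp at hz
  | cons p k ih =>
    by_cases h : p.1 = z
    · simp [val, mkState, h]
    · have := ih (by simpa [Ne.symm h] using hz)
      simpa [val, mkState, h] using this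

theorem eqOn_val_mkState (k : Ctx V C F) (e : V → Obj.{u, w} A) :
    Set.EqOn (val (mkState k e)) e (dom k) := fun _ hz => val_mkState e hz

/-- `restr` stops at the first variable outside `dom k`, which by `h` is the first variable of `k'`.
-/
theorem restr_mkState_append (k k' : Ctx V C F) (e : V → Obj.{u, w} A)
    (h : ∀ p ∈ k', p.1 ∉ dom k) : restr (mkState (k ++ k') e) (dom k) = mkState k e := by
  rw [restr, mkState_append, List.takeWhile_append_of_pos]
  · rcases k' with _ | ⟨p, k'⟩
    · simp [mkState]
    · simp [mkState, h p]
  · intro p hp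
    obtain ⟨q, hq, rfl⟩ := List.mem_map.1 hp
    simpa using fst_mem_dom hq

/-- The assignment gives each variable of `k` a member of the meaning of its set. -/
def Lang.Good (k : Ctx V C F) (e : V → Obj.{u, w} A) : Prop := ∀ p ∈ k, e p.1 ∈ L.evalS p.2 e

theorem Lang.good_append {k k' : Ctx V C F} {e : V → Obj.{u, w} A} :
    L.Good (k ++ k') e ↔ L.Good k e ∧ L.Good k' e := by
  simp [Lang.Good, or_imp, forall_and]

theorem Lang.good_singleton {p : V × Str V C F} {e : V → Obj.{u, w} A} :
    L.Good [p] e ↔ e p.1 ∈ L.evalS p.2 e := by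
  simp [Lang.Good]

theorem Lang.good_congr {k : Ctx V C F} {e e' : V → Obj.{u, w} A}
    (hk : ∀ p ∈ k, fvS p.2 ⊆ dom k) (h : Set.EqOn e e' (dom k)) :
    L.Good k e ↔ L.Good k e' := by
  refine forall₂_congr fun p hp => ?_
  rw [h (fst_mem_dom hp), L.evalS_congr p.2 (h.mono (hk p hp))]

section

variable {m : ℕ} (k : Ctx V C F) (y : Fin m → V) (ψs : Fin m → Str V C F)

theorem extend_last : extend k y ψs m = k ++ List.ofFn fun a => (y a, ψs a) := by
  rw [extend, List.take_of_length_le (by simp)]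

theorem dom_ofFn : dom (List.ofFn fun a => (y a, ψs a)) = Set.range y := by
  ext z
  simp [dom, List.mem_ofFn]

theorem dom_extend_last : dom (extend k y ψs m) = dom k ∪ Set.range y := by
  rw [extend_last, dom_append, dom_ofFn]

theorem dom_subset_dom_extend (j : ℕ) : dom k ⊆ dom (extend k y ψs j) := by
  simp [extend]

theorem dom_extend_subset (j : ℕ) : dom (extend k y ψs j) ⊆ dom k ∪ Set.range y := by
  rw [extend, dom_append, ← dom_ofFn y ψs]
  refine Set.union_subset_union_right _ ?_
  rintro z ⟨p, hp, rfl⟩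
  exact fst_mem_dom (List.mem_of_mem_take hp)

theorem good_extend_last {e : V → Obj.{u, w} A} :
    L.Good (extend k y ψs m) e ↔ L.Good k e ∧ ∀ j, e (y j) ∈ L.evalS (ψs j) e := by
  rw [extend_last, L.good_append]
  simp [Lang.Good, List.mem_ofFn]

end

end Domains

/-! ### The steps of the construction -/

namespace Stage

variable {V C F : Type*} {A : Type w} {S : Stage.{u, w} V C F A} {L : Lang.{u, w} V C F A}

/-- What is defined at the step `S` agrees with the reading of strings as parse trees. -/
structure Sound (S : Stage.{u, w} V C F A) (L : Lang.{u, w} V C F A) : Prop where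
  fv_ctx : ∀ {k}, k ∈ S.K → ∀ p ∈ k, fvS p.2 ⊆ dom k
  ctx_of_expr : ∀ {k t}, t ∈ S.E k → k ∈ S.K
  isTerm : ∀ {k t}, t ∈ S.E k → IsTerm t
  fv : ∀ {k t}, t ∈ S.E k → fvS t ⊆ dom k
  bv : ∀ {k t}, t ∈ S.E k → Disjoint (bvS t) (dom k)
  vb : ∀ {k t}, t ∈ S.E k → S.Vb t = bvS t
  xi : ∀ {k}, k ∈ S.K → ∀ σ, σ ∈ S.Xi k ↔ ∃ e, L.Good k e ∧ σ = mkState k e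
  den : ∀ {k t}, t ∈ S.E k → ∀ σ ∈ S.Xi k, S.den k t σ = L.evalS t (val σ)

theorem Sound.den_mkState (hS : S.Sound L) {k : Ctx V C F} {t : Str V C F} (ht : t ∈ S.E k)
    {e : V → Obj.{u, w} A} (he : L.Good k e) : S.den k t (mkState k e) = L.evalS t e := by
  rw [hS.den ht _ ((hS.xi (hS.ctx_of_expr ht) _).2 ⟨e, he, rfl⟩)]
  exact L.evalS_congr t ((eqOn_val_mkState k e).mono (hS.fv ht))

theorem Sound.forall_xi (hS : S.Sound L) {k : Ctx V C F} (hk : k ∈ S.K)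
    {P : State.{u, w} V A → Prop} : (∀ σ ∈ S.Xi k, P σ) ↔ ∀ e, L.Good k e → P (mkState k e) := by
  constructor
  · exact fun h e he => h _ ((hS.xi hk _).2 ⟨e, he, rfl⟩)
  · intro h σ hσ
    obtain ⟨e, he, rfl⟩ := (hS.xi hk _).1 hσ
    exact h e he

/-- Appending `(y, s)` to a state is updating the assignment at `y`. Since `y` is fresh, this
changes neither the state of `h` nor the meaning of `φ`. -/
theorem Sound.xi_snoc (hS : S.Sound L) {h : Ctx V C F} {y : V} {φ : Str V C F}
    (hw : S.CtxWF h y φ) (τ : State.{u, w} V A) :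
    (∃ σ ∈ S.Xi h, ∃ s ∈ S.den h φ σ, τ = σ ++ [(y, s)]) ↔
      ∃ e, L.Good (h ++ [(y, φ)]) e ∧ τ = mkState (h ++ [(y, φ)]) e := by
  classical
  constructor
  · rintro ⟨σ, hσ, s, hs, rfl⟩
    obtain ⟨e, he, rfl⟩ := (hS.xi hw.ctx _).1 hσ
    rw [hS.den_mkState hw.expr he] at hs
    have h1 : Set.EqOn (Function.update e y s) e (dom h) := fun z hz =>
      Function.update_of_ne (fun hzy : z = y => hw.fresh (hzy ▸ hz)) _ _
    refine ⟨Function.update e y s, ?_, ?_⟩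
    · rw [L.good_append, L.good_congr (hS.fv_ctx hw.ctx) h1, L.good_singleton,
        L.evalS_congr φ (h1.mono (hS.fv hw.expr))]
      exact ⟨he, by simpa using hs⟩
    · rw [mkState_append, mkState_congr h1]
      simp [mkState]
  · rintro ⟨e, he, rfl⟩
    rw [L.good_append, L.good_singleton] at he
    refine ⟨mkState h e, (hS.xi hw.ctx _).2 ⟨e, he.1, rfl⟩, e y, ?_, ?_⟩
    · rw [hS.den_mkState hw.expr he.1]
      exact he.2
    · rw [mkState_append]
      rfl

/-- Each clause proposes the value read off the parse tree, so overlapping clauses agree and the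
choice made in `Stage.next` is immaterial. -/
theorem Sound.newVb_eq (hS : S.Sound L) {t : Str V C F} {B : Set V} (h : S.NewVb L t B) :
    B = bvS t := by
  cases h with
  | a h y φ hw ht hy => exact hS.vb ht
  | b h y φ hw ht => subst ht; exact (bvS_var y).symm
  | c k m ψ ψs hw ht =>
    subst ht
    simp only [bvS_app (hS.isTerm hw.head) fun j => hS.isTerm (hw.args j), hS.vb hw.head,
      fun j => hS.vb (hw.args j)]
  | d k m f ψs hw ht =>
    subst ht
    simp only [bvS_op f fun j => hS.isTerm (hw.args j), fun j => hS.vb (hw.args j)]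
  | e k m y ψs ψ hw ht =>
    subst ht
    simp only [bvS_set y (hS.isTerm hw.body) fun j => hS.isTerm (hw.exprs j), hS.vb hw.body,
      fun j => hS.vb (hw.exprs j)]

/-- The counterpart of `newVb_eq` for meanings. The substantial case is the set builder, where
states extending a given one have to be matched with assignments that agree with `e` off the
binders. -/
theorem Sound.newDen_eq (hS : S.Sound L) {k : Ctx V C F} {t : Str V C F} {v : Obj.{u, w} A}
    {e : V → Obj.{u, w} A} (he : L.Good k e) (h : S.NewDen L k t (mkState k e) v) :
    v = L.evalS t e := by
  cases h with
  | a h y φ ρ s hw hk ht hy hσ =>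
    subst hk
    rw [mkState_append] at hσ
    obtain ⟨rfl, -⟩ := List.append_inj' hσ rfl
    exact hS.den_mkState ht (L.good_append.1 he).1
  | b h y φ hw hk ht =>
    subst hk ht
    rw [val_mkState _ (by simp), L.evalS_var]
  | c m ψ ψs hw ht =>
    subst ht
    simp only [L.evalS_app (hS.isTerm hw.head) fun j => hS.isTerm (hw.args j),
      hS.den_mkState hw.head he, fun j => hS.den_mkState (hw.args j) he]
  | d m f ψs hw ht =>
    subst ht
    simp only [L.evalS_op f fun j => hS.isTerm (hw.args j),
      fun j => hS.den_mkState (hw.args j) he]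
  | e m y ψs ψ hw ht =>
    classical
    subst ht
    rw [L.evalS_set y (hS.isTerm hw.body) fun j => hS.isTerm (hw.exprs j)]
    refine congrArg Obj.mkSet (Set.ext fun v => ?_)
    constructor
    · rintro ⟨σ', hσ', hp, rfl⟩
      obtain ⟨d, hd, rfl⟩ := (hS.xi hw.lastCtx _).1 hσ'
      rw [hS.den_mkState hw.body hd]
      -- The state of `k` given by `e` and the one given by `d` are initial segments of the same
      -- list and have the same length, hence are equal.
      have hde : Set.EqOn d e (dom k) := by
        rw [extend_last, mkState_append] at hp
        have h2 := List.prefix_of_prefix_length_le hp (List.prefix_append _ _)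
          (by simp [mkState])
        have h3 := h2.eq_of_length (by simp [mkState])
        intro z hz
        rw [← val_mkState d hz, ← h3, val_mkState e hz]
      -- Agreement with `e` is known only on `dom k`, but it is wanted at every variable that is not
      -- a binder. So `d` is replaced by `e` there, which no part of the expression notices.
      have h1 : Set.EqOn d (fun z => if z ∈ Set.range y then d z else e z)
          (dom (extend k y ψs m)) := by
        intro z hz
        by_cases hy : z ∈ Set.range y
        · simp only [hy, if_true]
        · simp only [hy, if_false]
          rw [dom_extend_last] at hz
          exact hde (hz.resolve_right hy)
      rw [L.good_congr (hS.fv_ctx hw.lastCtx) h1, good_extend_last] at hd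
      exact ⟨_, fun z hz => if_neg hz, hd.2, L.evalS_congr ψ (h1.mono (hS.fv hw.body))⟩
    · rintro ⟨d, h1, h2, rfl⟩
      have hde : Set.EqOn d e (dom k) := fun z hz => h1 z (by
        rintro ⟨j, rfl⟩
        exact hw.fresh j hz)
      have hd : L.Good (extend k y ψs m) d :=
        (good_extend_last L k y ψs).2 ⟨(L.good_congr (hS.fv_ctx hw.ctx) hde).2 he, h2⟩
      refine ⟨mkState (extend k y ψs m) d, (hS.xi hw.lastCtx _).2 ⟨d, hd, rfl⟩, ?_,
        (hS.den_mkState hw.body hd).symm⟩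
      rw [extend_last, mkState_append, mkState_congr hde]
      exact List.prefix_append _ _

end Stage
-- Monotonicity in the step, and soundness of the next step
namespace Stage

variable {V C F : Type*} {A : Type w} {S S' : Stage.{u, w} V C F A} {L : Lang.{u, w} V C F A}

/-- Under soundness the semantic condition speaks of assignments only, and the step enters just
through `S.E`. This characterisation and the three that follow make the formation conditions
monotone in the step, and allow them to be verified without reference to states. -/
theorem Sound.ctxWF_iff (hS : S.Sound L) {h : Ctx V C F} {y : V} {φ : Str V C F} :
    S.CtxWF h y φ ↔ φ ∈ S.E h ∧ y ∉ dom h ∧ ∀ e, L.Good h e → (L.evalS φ e).IsSet := by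
  have key : φ ∈ S.E h → ((∀ ρ ∈ S.Xi h, (S.den h φ ρ).IsSet) ↔
      ∀ e, L.Good h e → (L.evalS φ e).IsSet) := fun hφ => by
    rw [hS.forall_xi (hS.ctx_of_expr hφ)]
    exact forall₂_congr fun e he => by rw [hS.den_mkState hφ he]
  exact ⟨fun hw => ⟨hw.expr, hw.fresh, (key hw.expr).1 hw.isSet⟩,
    fun ⟨h1, h2, h3⟩ => ⟨hS.ctx_of_expr h1, h1, h2, (key h1).2 h3⟩⟩

theorem Sound.appWF_iff (hS : S.Sound L) {k : Ctx V C F} {m : ℕ} {ψ : Str V C F}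
    {ψs : Fin m → Str V C F} :
    S.AppWF k ψ ψs ↔ 0 < m ∧ ψ ∈ S.E k ∧ (∀ j, ψs j ∈ S.E k) ∧
      (∀ e, L.Good k e → (L.evalS ψ e).IsFunction m) ∧
      ∀ e, L.Good k e → (L.evalS ψ e).InDomain fun j => L.evalS (ψs j) e := by
  have key1 : ψ ∈ S.E k → ((∀ σ ∈ S.Xi k, (S.den k ψ σ).IsFunction m) ↔
      ∀ e, L.Good k e → (L.evalS ψ e).IsFunction m) := fun hψ => by
    rw [hS.forall_xi (hS.ctx_of_expr hψ)]
    exact forall₂_congr fun e he => by rw [hS.den_mkState hψ he]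
  have key2 : ψ ∈ S.E k → (∀ j, ψs j ∈ S.E k) →
      ((∀ σ ∈ S.Xi k, (S.den k ψ σ).InDomain fun j => S.den k (ψs j) σ) ↔
      ∀ e, L.Good k e → (L.evalS ψ e).InDomain fun j => L.evalS (ψs j) e) := fun hψ hψs => by
    rw [hS.forall_xi (hS.ctx_of_expr hψ)]
    exact forall₂_congr fun e he => by
      simp only [hS.den_mkState hψ he, fun j => hS.den_mkState (hψs j) he]
  exact ⟨fun hw => ⟨hw.pos, hw.head, hw.args, (key1 hw.head).1 hw.isFunction,
      (key2 hw.head hw.args).1 hw.inDomain⟩,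
    fun ⟨h1, h2, h3, h4, h5⟩ =>
      ⟨hS.ctx_of_expr h2, h1, h2, h3, (key1 h2).2 h4, (key2 h2 h3).2 h5⟩⟩

theorem Sound.opWF_iff (hS : S.Sound L) {k : Ctx V C F} {m : ℕ} {f : F}
    {ψs : Fin m → Str V C F} :
    S.OpWF L k f ψs ↔ 0 < m ∧ (∀ j, ψs j ∈ S.E k) ∧
      ∀ e, L.Good k e → L.app f (List.ofFn fun j => L.evalS (ψs j) e) := by
  have key : 0 < m → (∀ j, ψs j ∈ S.E k) →
      ((∀ σ ∈ S.Xi k, L.app f (List.ofFn fun j => S.den k (ψs j) σ)) ↔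
      ∀ e, L.Good k e → L.app f (List.ofFn fun j => L.evalS (ψs j) e)) := fun hm hψs => by
    rw [hS.forall_xi (hS.ctx_of_expr (hψs ⟨0, hm⟩))]
    exact forall₂_congr fun e he => by simp only [fun j => hS.den_mkState (hψs j) he]
  exact ⟨fun hw => ⟨hw.pos, hw.args, (key hw.pos hw.args).1 hw.applicable⟩,
    fun ⟨h1, h2, h3⟩ => ⟨hS.ctx_of_expr (h2 ⟨0, h1⟩), h1, h2, (key h1 h2).2 h3⟩⟩

theorem Sound.setWF_iff (hS : S.Sound L) {k : Ctx V C F} {m : ℕ} {y : Fin m → V}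
    {ψs : Fin m → Str V C F} {ψ : Str V C F} :
    S.SetWF k y ψs ψ ↔ 0 < m ∧ Function.Injective y ∧ (∀ j, y j ∉ dom k) ∧
      (∀ j : Fin m, ψs j ∈ S.E (extend k y ψs j)) ∧
      (∀ j : Fin m, ∀ e, L.Good (extend k y ψs j) e → (L.evalS (ψs j) e).IsSet) ∧
      ψ ∈ S.E (extend k y ψs m) := by
  have key : (∀ j : Fin m, ψs j ∈ S.E (extend k y ψs j)) →
      ((∀ j : Fin m, ∀ σ ∈ S.Xi (extend k y ψs j), (S.den (extend k y ψs j) (ψs j) σ).IsSet) ↔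
      ∀ j : Fin m, ∀ e, L.Good (extend k y ψs j) e → (L.evalS (ψs j) e).IsSet) := fun hψs => by
    refine forall_congr' fun j => ?_
    rw [hS.forall_xi (hS.ctx_of_expr (hψs j))]
    exact forall₂_congr fun e he => by rw [hS.den_mkState (hψs j) he]
  refine ⟨fun hw => ⟨hw.pos, hw.distinct, hw.fresh, hw.exprs, (key hw.exprs).1 hw.isSet, hw.body⟩,
    fun ⟨h1, h2, h3, h4, h5, h6⟩ => ⟨?_, h1, h2, h3, fun j => hS.ctx_of_expr (h4 j), h4,
      (key h4).2 h5, hS.ctx_of_expr h6, h6⟩⟩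
  -- `extend k y ψs 0` is `k`; there is a first binder because `0 < m`.
  have := hS.ctx_of_expr (h4 ⟨0, h1⟩)
  simpa [extend] using this

/-- Everything available at the step `S` is available at the step `S'`. -/
structure Le (S S' : Stage.{u, w} V C F A) : Prop where
  ctx : S.K ⊆ S'.K
  expr : ∀ k, S.E k ⊆ S'.E k

section

variable (hS : S.Sound L) (hS' : S'.Sound L) (hl : S.Le S')
include hS hS' hl

theorem CtxWF.mono {h : Ctx V C F} {y : V} {φ : Str V C F} (hw : S.CtxWF h y φ) :
    S'.CtxWF h y φ := by
  rw [hS.ctxWF_iff] at hw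
  exact hS'.ctxWF_iff.2 ⟨hl.expr _ hw.1, hw.2⟩

theorem AppWF.mono {k : Ctx V C F} {m : ℕ} {ψ : Str V C F} {ψs : Fin m → Str V C F}
    (hw : S.AppWF k ψ ψs) : S'.AppWF k ψ ψs := by
  rw [hS.appWF_iff] at hw
  obtain ⟨h1, h2, h3, h4⟩ := hw
  exact hS'.appWF_iff.2 ⟨h1, hl.expr _ h2, fun j => hl.expr _ (h3 j), h4⟩

theorem OpWF.mono {k : Ctx V C F} {m : ℕ} {f : F} {ψs : Fin m → Str V C F}
    (hw : S.OpWF L k f ψs) : S'.OpWF L k f ψs := by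
  rw [hS.opWF_iff] at hw
  obtain ⟨h1, h3, h4⟩ := hw
  exact hS'.opWF_iff.2 ⟨h1, fun j => hl.expr _ (h3 j), h4⟩

theorem SetWF.mono {k : Ctx V C F} {m : ℕ} {y : Fin m → V} {ψs : Fin m → Str V C F}
    {ψ : Str V C F} (hw : S.SetWF k y ψs ψ) : S'.SetWF k y ψs ψ := by
  rw [hS.setWF_iff] at hw
  obtain ⟨h1, h2, h3, h4, h5, h6⟩ := hw
  exact hS'.setWF_iff.2 ⟨h1, h2, h3, fun j => hl.expr _ (h4 j), h5, hl.expr _ h6⟩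

end

/-- Bound variables stay outside the domain: clause (a) demands that the new variable not be bound
in `t`, and in clause (e) the binders are fresh while the parts are expressions of larger contexts.
-/
theorem Sound.next (hS : S.Sound L) : (S.next L).Sound L := by
  have hctx : ∀ {k t}, t ∈ (S.next L).E k → k ∈ (S.next L).K := by
    rintro k t (((((h | ⟨h, y, φ, hw, rfl, -⟩) | ⟨h, y, φ, hw, rfl, -⟩) | ⟨m, ψ, ψs, hw, -⟩) |
      ⟨m, f, ψs, hw, -⟩) | ⟨m, y, ψs, ψ, hw, -⟩)
    · exact Or.inl h.1
    · exact Or.inr ⟨h, y, φ, hw, rfl⟩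
    · exact Or.inr ⟨h, y, φ, hw, rfl⟩
    · exact Or.inl hw.ctx
    · exact Or.inl hw.ctx
    · exact Or.inl hw.ctx
  have hall : ∀ {k t}, t ∈ (S.next L).E k →
      IsTerm t ∧ fvS t ⊆ dom k ∧ Disjoint (bvS t) (dom k) := by
    rintro k t (((((h | ⟨h, y, φ, hw, rfl, ht, hy⟩) | ⟨h, y, φ, hw, rfl, rfl⟩) |
      ⟨m, ψ, ψs, hw, rfl⟩) | ⟨m, f, ψs, hw, rfl⟩) | ⟨m, y, ψs, ψ, hw, rfl⟩)
    · exact ⟨hS.isTerm h.2, hS.fv h.2, hS.bv h.2⟩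
    · rw [hS.vb ht] at hy
      refine ⟨hS.isTerm ht, (hS.fv ht).trans (by simp), ?_⟩
      simpa [hy] using hS.bv ht
    · simp [isTerm_var, fvS_var, bvS_var]
    · have h1 := hS.isTerm hw.head
      have h2 := fun j => hS.isTerm (hw.args j)
      refine ⟨isTerm_app h1 h2, ?_, ?_⟩
      · rw [fvS_app h1 h2]
        exact Set.union_subset (hS.fv hw.head) (Set.iUnion_subset fun j => hS.fv (hw.args j))
      · rw [bvS_app h1 h2, Set.disjoint_union_left, Set.disjoint_iUnion_left]
        exact ⟨hS.bv hw.head, fun j => hS.bv (hw.args j)⟩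
    · have h2 := fun j => hS.isTerm (hw.args j)
      refine ⟨isTerm_op f h2, ?_, ?_⟩
      · rw [fvS_op f h2]
        exact Set.iUnion_subset fun j => hS.fv (hw.args j)
      · rw [bvS_op f h2, Set.disjoint_iUnion_left]
        exact fun j => hS.bv (hw.args j)
    · have h1 := hS.isTerm hw.body
      have h2 := fun j => hS.isTerm (hw.exprs j)
      refine ⟨isTerm_set y h1 h2, ?_, ?_⟩
      · rw [fvS_set y h1 h2, Set.sdiff_subset_iff, Set.union_comm (Set.range y)]
        exact Set.union_subset
          (Set.iUnion_subset fun j => (hS.fv (hw.exprs j)).trans (dom_extend_subset _ _ _ _))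
          ((hS.fv hw.body).trans (dom_extend_subset _ _ _ _))
      · rw [bvS_set y h1 h2, Set.disjoint_union_left, Set.disjoint_union_left,
          Set.disjoint_iUnion_left]
        refine ⟨⟨Set.disjoint_left.2 ?_, fun j => ?_⟩, ?_⟩
        · rintro _ ⟨j, rfl⟩
          exact hw.fresh j
        · exact (hS.bv (hw.exprs j)).mono_right (dom_subset_dom_extend _ _ _ _)
        · exact (hS.bv hw.body).mono_right (dom_subset_dom_extend _ _ _ _)
  have hxi : ∀ {k}, k ∈ (S.next L).K → ∀ σ, σ ∈ (S.next L).Xi k ↔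
      ∃ e, L.Good k e ∧ σ = mkState k e := by
    intro k hk σ
    by_cases hkS : k ∈ S.K
    · rw [← hS.xi hkS]
      simp [Stage.next, hkS]
    · obtain ⟨h, y, φ, hw, rfl⟩ := hk.resolve_left hkS
      rw [← hS.xi_snoc hw]
      simp only [Stage.next, hkS, false_and, not_false_eq_true, true_and, false_or,
        Set.mem_ofPred_eq]
      constructor
      · rintro ⟨h', y', φ', hw', heq, H⟩
        obtain ⟨h1, h2⟩ := List.append_inj' heq rfl
        simp only [List.cons.injEq, Prod.mk.injEq, and_true] at h2
        obtain ⟨rfl, rfl⟩ := h2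
        subst h1
        exact H
      · exact fun H => ⟨h, y, φ, hw, rfl, H⟩
  refine ⟨?_, hctx, fun ht => (hall ht).1, fun ht => (hall ht).2.1, fun ht => (hall ht).2.2,
    ?_, hxi, ?_⟩
  · rintro k (hk | ⟨h, y, φ, hw, rfl⟩) p hp
    · exact hS.fv_ctx hk p hp
    · rw [List.mem_append, List.mem_singleton] at hp
      refine Set.Subset.trans ?_ (by simp : dom h ⊆ _)
      rcases hp with hp | rfl
      · exact hS.fv_ctx hw.ctx p hp
      · exact hS.fv hw.expr
  · intro k t ht
    by_cases hold : ∃ k ∈ S.K, t ∈ S.E k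
    · simp only [Stage.next, if_pos hold]
      obtain ⟨k', -, h⟩ := hold
      exact hS.vb h
    · have hex : ∃ B, S.NewVb L t B := by
        rcases ht with (((((h | ⟨h, y, φ, hw, -, ht, hy⟩) | ⟨h, y, φ, hw, -, ht⟩) |
          ⟨m, ψ, ψs, hw, ht⟩) | ⟨m, f, ψs, hw, ht⟩) | ⟨m, y, ψs, ψ, hw, ht⟩)
        · exact (hold ⟨k, h⟩).elim
        · exact ⟨_, .a h y φ hw ht hy⟩
        · exact ⟨_, .b h y φ hw ht⟩
        · exact ⟨_, .c k m ψ ψs hw ht⟩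
        · exact ⟨_, .d k m f ψs hw ht⟩
        · exact ⟨_, .e k m y ψs ψ hw ht⟩
      simp only [Stage.next, if_neg hold, dif_pos hex]
      exact hS.newVb_eq hex.choose_spec
  · intro k t ht σ hσ
    obtain ⟨e, he, rfl⟩ := (hxi (hctx ht) σ).1 hσ
    rw [L.evalS_congr t ((eqOn_val_mkState k e).mono (hall ht).2.1)]
    by_cases hold : k ∈ S.K ∧ t ∈ S.E k
    · simp only [Stage.next, if_pos hold]
      exact hS.den_mkState hold.2 he
    · have hex : ∃ v, S.NewDen L k t (mkState k e) v := by
        rcases ht with (((((h | ⟨h, y, φ, hw, hk, ht, hy⟩) | ⟨h, y, φ, hw, hk, ht⟩) |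
          ⟨m, ψ, ψs, hw, ht⟩) | ⟨m, f, ψs, hw, ht⟩) | ⟨m, y, ψs, ψ, hw, ht⟩)
        · exact (hold h).elim
        · exact ⟨_, .a h y φ (mkState h e) (e y) hw hk ht hy (by rw [hk, mkState_append]; rfl)⟩
        · exact ⟨_, .b h y φ hw hk ht⟩
        · exact ⟨_, .c m ψ ψs hw ht⟩
        · exact ⟨_, .d m f ψs hw ht⟩
        · exact ⟨_, .e m y ψs ψ hw ht⟩
      simp only [Stage.next, if_neg hold, dif_pos hex]
      exact hS.newDen_eq he hex.choose_spec

end Stage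

/-! ### The steps of a language and their union -/

namespace Lang

open Stage Filter

variable {V C F : Type*} {A : Type w} (L : Lang.{u, w} V C F A)

theorem sound_first : L.first.Sound L where
  fv_ctx hk p hp := by
    rw [Set.mem_singleton_iff.1 hk] at hp
    simp at hp
  ctx_of_expr ht := ht.1
  isTerm ht := by
    obtain ⟨-, c, rfl⟩ := ht
    exact isTerm_const c
  fv ht := by
    obtain ⟨-, c, rfl⟩ := ht
    simp [fvS_const]
  bv ht := by
    obtain ⟨-, c, rfl⟩ := ht
    simp [bvS_const]
  vb ht := by
    obtain ⟨-, c, rfl⟩ := ht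
    exact (bvS_const c).symm
  xi hk σ := by
    rw [Set.mem_singleton_iff.1 hk]
    simp [first, Good, mkState]
  den ht σ hσ := by
    obtain ⟨-, c, rfl⟩ := ht
    exact (L.evalS_const c _).symm

theorem stage_succ {n : ℕ} (hn : 1 ≤ n) : L.stage (n + 1) = (L.stage n).next L := by
  obtain ⟨n, rfl⟩ := Nat.exists_eq_add_of_le' hn
  rfl

theorem sound (n : ℕ) : (L.stage n).Sound L := by
  induction n with
  | zero => exact L.sound_first
  | succ n ih =>
    rcases n with _ | n
    · exact L.sound_first
    · exact ih.next

theorem stage_le_succ (n : ℕ) : (L.stage n).Le (L.stage (n + 1)) := by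
  rcases n with _ | n
  · exact ⟨subset_rfl, fun _ => subset_rfl⟩
  · exact ⟨Set.subset_union_left, fun k t ht =>
      Or.inl (Or.inl (Or.inl (Or.inl (Or.inl ⟨(L.sound _).ctx_of_expr ht, ht⟩))))⟩

theorem stage_le {n m : ℕ} (h : n ≤ m) : (L.stage n).Le (L.stage m) := by
  induction h with
  | refl => exact ⟨subset_rfl, fun _ => subset_rfl⟩
  | step _ ih =>
    exact ⟨ih.ctx.trans (L.stage_le_succ _).ctx,
      fun k => (ih.expr k).trans ((L.stage_le_succ _).expr k)⟩

/-- In the form `∀ᶠ`, finitely many memberships can be brought to one common step by intersecting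
filter sets. -/
theorem mem_K_iff {k : Ctx V C F} : k ∈ L.K ↔ ∀ᶠ n in atTop, k ∈ (L.stage n).K := by
  constructor
  · rintro ⟨n, -, hk⟩
    exact eventually_atTop.2 ⟨n, fun m hm => (L.stage_le hm).ctx hk⟩
  · intro h
    obtain ⟨n, h1, h2⟩ := ((eventually_ge_atTop 1).and h).exists
    exact ⟨n, h1, h2⟩

theorem mem_E_iff {k : Ctx V C F} {t : Str V C F} :
    t ∈ L.E k ↔ ∀ᶠ n in atTop, t ∈ (L.stage n).E k := by
  constructor
  · rintro ⟨n, -, -, ht⟩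
    exact eventually_atTop.2 ⟨n, fun m hm => (L.stage_le hm).expr k ht⟩
  · intro h
    obtain ⟨n, h1, h2⟩ := ((eventually_ge_atTop 1).and h).exists
    exact ⟨n, h1, (L.sound n).ctx_of_expr h2, h2⟩

theorem mem_K_of_stage {n : ℕ} {k : Ctx V C F} (hk : k ∈ (L.stage n).K) : k ∈ L.K :=
  L.mem_K_iff.2 (eventually_atTop.2 ⟨n, fun _ hm => (L.stage_le hm).ctx hk⟩)

theorem mem_E_of_stage {n : ℕ} {k : Ctx V C F} {t : Str V C F} (ht : t ∈ (L.stage n).E k) :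
    t ∈ L.E k :=
  L.mem_E_iff.2 (eventually_atTop.2 ⟨n, fun _ hm => (L.stage_le hm).expr k ht⟩)

variable {L}

section

variable {k : Ctx V C F} {t : Str V C F}

theorem exists_stage_E (ht : t ∈ L.E k) : ∃ n, 1 ≤ n ∧ t ∈ (L.stage n).E k :=
  let ⟨n, h1, _, h2⟩ := ht
  ⟨n, h1, h2⟩

theorem ctx_of_expr (ht : t ∈ L.E k) : k ∈ L.K :=
  let ⟨n, h1, h2, _⟩ := ht
  ⟨n, h1, h2⟩

theorem isTerm_of_expr (ht : t ∈ L.E k) : IsTerm t :=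
  let ⟨n, _, _, h⟩ := ht
  (L.sound n).isTerm h

theorem fvS_subset (ht : t ∈ L.E k) : fvS t ⊆ dom k :=
  let ⟨n, _, _, h⟩ := ht
  (L.sound n).fv h

theorem disjoint_bvS (ht : t ∈ L.E k) : Disjoint (bvS t) (dom k) :=
  let ⟨n, _, _, h⟩ := ht
  (L.sound n).bv h

/-- At its first step, `t` may be an expression of a context other than `k`; the parse tree is the
same. -/
theorem Vb_eq (ht : t ∈ L.E k) : L.Vb t = bvS t := by
  have hne : {n | 1 ≤ n ∧ ∃ k ∈ (L.stage n).K, t ∈ (L.stage n).E k}.Nonempty := by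
    obtain ⟨n, h1, h2, h3⟩ := ht
    exact ⟨n, h1, k, h2, h3⟩
  obtain ⟨-, k', -, h⟩ := Nat.sInf_mem hne
  exact (L.sound _).vb h

theorem mem_Xi_iff (hk : k ∈ L.K) (σ : State.{u, w} V A) :
    σ ∈ L.Xi k ↔ ∃ e, L.Good k e ∧ σ = mkState k e := by
  constructor
  · rintro ⟨n, -, hk, hσ⟩
    exact ((L.sound n).xi hk σ).1 hσ
  · intro h
    obtain ⟨n, h1, hk⟩ := hk
    exact ⟨n, h1, hk, ((L.sound n).xi hk σ).2 h⟩

theorem forall_Xi (hk : k ∈ L.K) {P : State.{u, w} V A → Prop} :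
    (∀ σ ∈ L.Xi k, P σ) ↔ ∀ e, L.Good k e → P (mkState k e) := by
  constructor
  · exact fun h e he => h _ ((mem_Xi_iff hk _).2 ⟨e, he, rfl⟩)
  · intro h σ hσ
    obtain ⟨e, he, rfl⟩ := (mem_Xi_iff hk _).1 hσ
    exact h e he

theorem den_mkState (ht : t ∈ L.E k) {e : V → Obj.{u, w} A} (he : L.Good k e) :
    L.den k t (mkState k e) = L.evalS t e := by
  have hne : {n | 1 ≤ n ∧ k ∈ (L.stage n).K ∧ t ∈ (L.stage n).E k}.Nonempty := ht
  obtain ⟨-, -, h⟩ := Nat.sInf_mem hne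
  exact (L.sound _).den_mkState h he

end

/-! ### Rules of formation for the limit of the construction -/

theorem eventually_ctxWF {h : Ctx V C F} {y : V} {φ : Str V C F} (hφ : φ ∈ L.E h)
    (hy : y ∉ dom h) (hs : ∀ e, L.Good h e → (L.evalS φ e).IsSet) :
    ∀ᶠ n in atTop, 1 ≤ n ∧ (L.stage n).CtxWF h y φ := by
  filter_upwards [L.mem_E_iff.1 hφ, eventually_ge_atTop 1] with n h1 h2
  exact ⟨h2, (L.sound n).ctxWF_iff.2 ⟨h1, hy, hs⟩⟩

theorem snoc_mem_K {h : Ctx V C F} {y : V} {φ : Str V C F} (hφ : φ ∈ L.E h)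
    (hy : y ∉ dom h) (hs : ∀ e, L.Good h e → (L.evalS φ e).IsSet) : h ++ [(y, φ)] ∈ L.K := by
  obtain ⟨n, hn, hw⟩ := (eventually_ctxWF hφ hy hs).exists
  refine L.mem_K_of_stage (n := n + 1) ?_
  rw [L.stage_succ hn]
  exact Or.inr ⟨h, y, φ, hw, rfl⟩

theorem weaken_mem_E {h : Ctx V C F} {y : V} {φ t : Str V C F} (hφ : φ ∈ L.E h)
    (hy : y ∉ dom h) (hs : ∀ e, L.Good h e → (L.evalS φ e).IsSet) (ht : t ∈ L.E h)
    (hyt : y ∉ bvS t) : t ∈ L.E (h ++ [(y, φ)]) := by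
  obtain ⟨n, ⟨hn, hw⟩, ht⟩ := ((eventually_ctxWF hφ hy hs).and (L.mem_E_iff.1 ht)).exists
  refine L.mem_E_of_stage (n := n + 1) ?_
  rw [L.stage_succ hn]
  exact Or.inl (Or.inl (Or.inl (Or.inl (Or.inr
    ⟨h, y, φ, hw, rfl, ht, by rwa [(L.sound n).vb ht]⟩))))

theorem var_mem_E {h : Ctx V C F} {y : V} {φ : Str V C F} (hφ : φ ∈ L.E h)
    (hy : y ∉ dom h) (hs : ∀ e, L.Good h e → (L.evalS φ e).IsSet) :
    [Symb.var y] ∈ L.E (h ++ [(y, φ)]) := by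
  obtain ⟨n, hn, hw⟩ := (eventually_ctxWF hφ hy hs).exists
  refine L.mem_E_of_stage (n := n + 1) ?_
  rw [L.stage_succ hn]
  exact Or.inl (Or.inl (Or.inl (Or.inr ⟨h, y, φ, hw, rfl, rfl⟩)))

theorem app_mem_E {k : Ctx V C F} {m : ℕ} {ψ : Str V C F} {ψs : Fin m → Str V C F} (hm : 0 < m)
    (hψ : ψ ∈ L.E k) (hψs : ∀ j, ψs j ∈ L.E k)
    (hf : ∀ e, L.Good k e → (L.evalS ψ e).IsFunction m)
    (hd : ∀ e, L.Good k e → (L.evalS ψ e).InDomain fun j => L.evalS (ψs j) e) :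
    appStr ψ ψs ∈ L.E k := by
  obtain ⟨n, ⟨h1, h2⟩, hn⟩ := (((L.mem_E_iff.1 hψ).and
    (eventually_all.2 fun j => L.mem_E_iff.1 (hψs j))).and (eventually_ge_atTop 1)).exists
  refine L.mem_E_of_stage (n := n + 1) ?_
  rw [L.stage_succ hn]
  exact Or.inl (Or.inl (Or.inr
    ⟨m, ψ, ψs, (L.sound n).appWF_iff.2 ⟨hm, h1, h2, hf, hd⟩, rfl⟩))

theorem op_mem_E {k : Ctx V C F} {m : ℕ} {f : F} {ψs : Fin m → Str V C F} (hm : 0 < m)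
    (hψs : ∀ j, ψs j ∈ L.E k)
    (hf : ∀ e, L.Good k e → L.app f (List.ofFn fun j => L.evalS (ψs j) e)) :
    opStr f ψs ∈ L.E k := by
  obtain ⟨n, h2, hn⟩ := ((eventually_all.2 fun j => L.mem_E_iff.1 (hψs j)).and
    (eventually_ge_atTop 1)).exists
  refine L.mem_E_of_stage (n := n + 1) ?_
  rw [L.stage_succ hn]
  exact Or.inl (Or.inr ⟨m, f, ψs, (L.sound n).opWF_iff.2 ⟨hm, h2, hf⟩, rfl⟩)

theorem set_mem_E {k : Ctx V C F} {m : ℕ} {y : Fin m → V} {ψs : Fin m → Str V C F}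
    {ψ : Str V C F} (hm : 0 < m) (hy : Function.Injective y) (hk : ∀ j, y j ∉ dom k)
    (hψs : ∀ j : Fin m, ψs j ∈ L.E (extend k y ψs j))
    (hs : ∀ j : Fin m, ∀ e, L.Good (extend k y ψs j) e → (L.evalS (ψs j) e).IsSet)
    (hψ : ψ ∈ L.E (extend k y ψs m)) : setStr y ψs ψ ∈ L.E k := by
  obtain ⟨n, ⟨h1, h2⟩, hn⟩ := (((L.mem_E_iff.1 hψ).and
    (eventually_all.2 fun j => L.mem_E_iff.1 (hψs j))).and (eventually_ge_atTop 1)).exists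
  refine L.mem_E_of_stage (n := n + 1) ?_
  rw [L.stage_succ hn]
  exact Or.inr ⟨m, y, ψs, ψ, (L.sound n).setWF_iff.2 ⟨hm, hy, hk, h2, hs, h1⟩, rfl⟩

end Lang
namespace Lang

open Stage

variable {V C F : Type*} {A : Type w} {L : Lang.{u, w} V C F A}

/-! ### The shape of contexts and expressions -/

/-- Steps `0` and `1` coincide and `next` acts only from step `1` on, hence the two base cases. -/
theorem stage_induction {P : ℕ → Prop} (h0 : P 0) (h1 : P 1) (hs : ∀ n, 1 ≤ n → P n → P (n + 1))
    (n : ℕ) : P n := by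
  induction n with
  | zero => exact h0
  | succ n ih =>
    rcases n with _ | n
    · exact h1
    · exact hs _ (Nat.le_add_left _ _) ih

/-- A step keeps a context or appends one pair, so every pair of a context was once the appended
one, over the part that precedes it. -/
theorem ctxWF_of_stage (n : ℕ) : ∀ {a b : Ctx V C F} {y : V} {φ : Str V C F},
    a ++ (y, φ) :: b ∈ (L.stage n).K → (L.stage (n - 1)).CtxWF a y φ := by
  have hfirst : ∀ {a b : Ctx V C F} {y : V} {φ : Str V C F}, a ++ (y, φ) :: b ∉ L.first.K :=
    fun h => by simp [first] at h
  induction n using stage_induction with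
  | h0 => exact fun h => (hfirst h).elim
  | h1 => exact fun h => (hfirst h).elim
  | hs n hn ih =>
    intro a b y φ h
    have ih' : ∀ {a b : Ctx V C F} {y : V} {φ : Str V C F},
        a ++ (y, φ) :: b ∈ (L.stage n).K → (L.stage n).CtxWF a y φ := fun h =>
      (ih h).mono (L.sound _) (L.sound _) (L.stage_le (Nat.sub_le n 1))
    rw [L.stage_succ hn] at h
    rcases h with h | ⟨h', y', φ', hw, heq⟩
    · exact ih' h
    · rcases List.eq_nil_or_concat' b with rfl | ⟨b, q, rfl⟩
      · obtain ⟨h1, h2⟩ := List.append_inj' heq rfl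
        simp only [List.cons.injEq, Prod.mk.injEq, and_true] at h2
        obtain ⟨rfl, rfl⟩ := h2
        subst h1
        exact hw
      · rw [← List.cons_append, ← List.append_assoc] at heq
        obtain ⟨rfl, -⟩ := List.append_inj' heq rfl
        exact ih' hw.ctx

theorem ctxWF_of_stage' {n : ℕ} {a b : Ctx V C F} {y : V} {φ : Str V C F}
    (h : a ++ (y, φ) :: b ∈ (L.stage n).K) : (L.stage n).CtxWF a y φ :=
  (ctxWF_of_stage n h).mono (L.sound _) (L.sound _) (L.stage_le (Nat.sub_le n 1))

theorem length_lt_of_stage (n : ℕ) (hn : 1 ≤ n) :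
    ∀ {k : Ctx V C F}, k ∈ (L.stage n).K → k.length < n := by
  induction n, hn using Nat.le_induction with
  | base =>
    intro k hk
    rw [Set.mem_singleton_iff.1 hk]
    simp
  | succ n hn ih =>
    intro k hk
    rw [L.stage_succ hn] at hk
    rcases hk with hk | ⟨h, y, φ, hw, rfl⟩
    · exact (ih hk).trans (Nat.lt_succ_self n)
    · simpa using ih hw.ctx

theorem fresh_of_mem_K {a b : Ctx V C F} {y : V} {φ : Str V C F} (h : a ++ (y, φ) :: b ∈ L.K) :
    y ∉ dom a := by
  obtain ⟨n, -, h⟩ := h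
  exact (ctxWF_of_stage n h).fresh

theorem expr_of_mem_K {a b : Ctx V C F} {y : V} {φ : Str V C F} (h : a ++ (y, φ) :: b ∈ L.K) :
    φ ∈ L.E a := by
  obtain ⟨n, -, h⟩ := h
  exact L.mem_E_of_stage (ctxWF_of_stage n h).expr

theorem fresh_right_of_mem_K {a b : Ctx V C F} (h : a ++ b ∈ L.K) :
    ∀ p ∈ b, p.1 ∉ dom a := by
  intro p hp
  obtain ⟨b₁, b₂, rfl⟩ := List.append_of_mem hp
  rw [← List.append_assoc] at h
  intro hpa
  exact fresh_of_mem_K (φ := p.2) h (by simp [hpa])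

theorem nodup_of_mem_K {k : Ctx V C F} (hk : k ∈ L.K) : (k.map Prod.fst).Nodup := by
  obtain ⟨n, -, hk⟩ := hk
  suffices h : ∀ l r : Ctx V C F, k = l ++ r → (l.map Prod.fst).Nodup from h k [] (by simp)
  intro l
  induction l using List.reverseRecOn with
  | nil => simp
  | append_singleton l p ih =>
    intro r hr
    subst hr
    rw [List.append_assoc, List.singleton_append] at hk ih
    have := (ctxWF_of_stage n (φ := p.2) hk).fresh
    rw [List.map_append, List.map_singleton, List.nodup_append_comm, List.singleton_append,
      List.nodup_cons]
    refine ⟨fun h => this ?_, ih _ rfl⟩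
    obtain ⟨q, hq, hqp⟩ := List.mem_map.1 h
    exact ⟨q, hq, hqp⟩

theorem prefix_mem_K {a b : Ctx V C F} (h : a ++ b ∈ L.K) : a ∈ L.K := by
  rcases b with _ | ⟨p, b⟩
  · simpa using h
  · exact ctx_of_expr (expr_of_mem_K (y := p.1) (φ := p.2) h)

/-- The ways in which an expression of the step `n` is formed. -/
inductive Formed (L : Lang.{u, w} V C F A) (n : ℕ) (k : Ctx V C F) (φ : Str V C F) : Prop
  | const (c : C) : φ = [Symb.const c] → Formed L n k φ
  | var (z : V) : φ = [Symb.var z] → z ∈ dom k → Formed L n k φ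
  | app (κ : Ctx V C F) (m : ℕ) (ψ : Str V C F) (ψs : Fin m → Str V C F) :
      κ <+: k → (L.stage (n - 1)).AppWF κ ψ ψs → φ = appStr ψ ψs → φ ∈ (L.stage n).E κ →
      Formed L n k φ
  | op (κ : Ctx V C F) (m : ℕ) (f : F) (ψs : Fin m → Str V C F) :
      κ <+: k → (L.stage (n - 1)).OpWF L κ f ψs → φ = opStr f ψs → φ ∈ (L.stage n).E κ →
      Formed L n k φ
  | set (κ : Ctx V C F) (m : ℕ) (y : Fin m → V) (ψs : Fin m → Str V C F) (ψ : Str V C F) :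
      κ <+: k → (L.stage (n - 1)).SetWF κ y ψs ψ → φ = setStr y ψs ψ → φ ∈ (L.stage n).E κ →
      Formed L n k φ

theorem Formed.mono {n : ℕ} {h k : Ctx V C F} {φ : Str V C F} (hf : Formed L n h φ)
    (hk : h <+: k) : Formed L (n + 1) k φ := by
  have hl := L.stage_le (Nat.sub_le_sub_right (Nat.le_succ n) 1)
  have hl' := (L.stage_le_succ n).expr
  cases hf with
  | const c hc => exact .const c hc
  | var z hz hd =>
    obtain ⟨r, rfl⟩ := hk
    exact .var z hz (by simp [hd])
  | app κ m ψ ψs hκ hw ht he =>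
    exact .app κ m ψ ψs (hκ.trans hk) (hw.mono (L.sound _) (L.sound _) hl) ht (hl' _ he)
  | op κ m f ψs hκ hw ht he =>
    exact .op κ m f ψs (hκ.trans hk) (hw.mono (L.sound _) (L.sound _) hl) ht (hl' _ he)
  | set κ m y ψs ψ hκ hw ht he =>
    exact .set κ m y ψs ψ (hκ.trans hk) (hw.mono (L.sound _) (L.sound _) hl) ht (hl' _ he)

/-- Unwinding clause (a) only shortens the context, so the clause that really built `φ` is found at
an initial segment `κ` of `k`. -/
theorem formed_of_stage (n : ℕ) : ∀ {k : Ctx V C F} {φ : Str V C F},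
    φ ∈ (L.stage n).E k → Formed L n k φ := by
  induction n using stage_induction with
  | h0 =>
    rintro k φ ⟨-, c, hc⟩
    exact .const c hc
  | h1 =>
    rintro k φ ⟨-, c, hc⟩
    exact .const c hc
  | hs n hn ih =>
    intro k φ h
    have hmem := h
    rw [L.stage_succ hn] at h
    rcases h with (((((h | ⟨h, y, χ, hw, rfl, ht, -⟩) | ⟨h, y, χ, hw, rfl, ht⟩) |
      ⟨m, ψ, ψs, hw, ht⟩) | ⟨m, f, ψs, hw, ht⟩) | ⟨m, y, ψs, ψ, hw, ht⟩)
    · exact (ih h.2).mono List.prefix_rfl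
    · exact (ih ht).mono (List.prefix_append _ _)
    · exact .var y ht (by simp)
    · exact .app k m ψ ψs List.prefix_rfl hw ht hmem
    · exact .op k m f ψs List.prefix_rfl hw ht hmem
    · exact .set k m y ψs ψ List.prefix_rfl hw ht hmem

/-! ### The value of the substitution clauses -/

theorem subExpr_exists (x : V) {t : Str V C F} (ht : IsTerm t) (n : ℕ) :
    ∀ {k : Ctx V C F} {φ : Str V C F}, φ ∈ (L.stage n).E k → x ∈ dom k →
      L.SubExpr x t k φ (subS x t φ) := by
  induction n using stage_induction with
  | h0 =>
    rintro k φ ⟨rfl, -⟩ hx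
    simp at hx
  | h1 =>
    rintro k φ ⟨rfl, -⟩ hx
    simp at hx
  | hs n hn ih =>
    intro k φ h hx
    have hS := L.sound n
    rw [L.stage_succ hn] at h
    rcases h with (((((h | ⟨h, y, χ, hw, rfl, hφ, hy⟩) | ⟨h, y, χ, hw, rfl, rfl⟩) |
      ⟨m, ψ, ψs, hw, rfl⟩) | ⟨m, f, ψs, hw, rfl⟩) | ⟨m, y, ψs, ψ, hw, rfl⟩)
    · exact ih h.2 hx
    · by_cases hyx : y = x
      · subst hyx
        -- Here the clause returns `φ` itself. The replacement does so too, since `x` is neither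
        -- free in `φ` (it is not in `dom h`) nor bound in it.
        rw [subS_eq_self (fun hf => hw.fresh (hS.fv hφ hf)) (by rwa [← hS.vb hφ])]
        exact .a_last n _ h χ φ hn hw rfl hφ hy
      · have hxh : x ∈ dom h := by simpa [Ne.symm hyx] using hx
        exact .a_step n _ h y χ φ _ hn hw rfl hxh hφ hy (ih hφ hxh)
    · by_cases hyx : y = x
      · subst hyx
        rw [subS_var_self y ht]
        exact .b_last n _ h χ hn hw rfl
      · have hxh : x ∈ dom h := by simpa [Ne.symm hyx] using hx
        rw [subS_var_of_ne x ht hyx]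
        exact .b_step n _ h y χ hn hw rfl hxh
    · rw [subS_app x ht (hS.isTerm hw.head) fun j => hS.isTerm (hw.args j)]
      exact .c n k m ψ _ ψs _ hn hw (ih hw.head hx) fun j => ih (hw.args j) hx
    · rw [subS_op x ht f fun j => hS.isTerm (hw.args j)]
      exact .d n k m f ψs _ hn hw fun j => ih (hw.args j) hx
    · rw [subS_set x ht y (hS.isTerm hw.body) fun j => hS.isTerm (hw.exprs j)]
      exact .e n k m y ψs _ ψ _ hn hw
        (fun j => ih (hw.exprs j) (dom_subset_dom_extend _ _ _ _ hx))
        (ih hw.body (dom_subset_dom_extend _ _ _ _ hx))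

/-- Each clause commutes with the reading of strings as trees. As the right-hand side mentions
neither the context nor the clause, this is both uniqueness and independence of the context. -/
theorem SubExpr.eq_subS {x : V} {t : Str V C F} (ht : IsTerm t) {k : Ctx V C F}
    {φ φ' : Str V C F} (h : L.SubExpr x t k φ φ') : φ' = subS x t φ := by
  induction h with
  | a_last n k h χ φ hn hw hk hφ hx =>
    have hS := L.sound n
    exact (subS_eq_self (fun hf => hw.fresh (hS.fv hφ hf)) (by rwa [← hS.vb hφ])).symm
  | a_step n k h y χ φ φ' hn hw hk hx hφ hy _ ih => exact ih
  | b_last n k h χ hn hw hk => exact (subS_var_self x ht).symm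
  | b_step n k h y χ hn hw hk hx =>
    exact (subS_var_of_ne x ht fun hyx : y = x => hw.fresh (hyx ▸ hx)).symm
  | c n k m ψ ψ' ψs ψs' hn hw _ _ ih ihs =>
    have hS := L.sound n
    rw [subS_app x ht (hS.isTerm hw.head) fun j => hS.isTerm (hw.args j), ih, funext ihs]
  | d n k m f ψs ψs' hn hw _ ihs =>
    have hS := L.sound n
    rw [subS_op x ht f fun j => hS.isTerm (hw.args j), funext ihs]
  | e n k m y ψs ψs' ψ ψ' hn hw _ _ ihs ih =>
    have hS := L.sound n
    rw [subS_set x ht y (hS.isTerm hw.body) fun j => hS.isTerm (hw.exprs j), ih, funext ihs]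

section

variable {k : Ctx V C F} {x : V} {t φ : Str V C F}

theorem subExpr_of_expr (ht : IsTerm t) (hφ : φ ∈ L.E k) (hx : x ∈ dom k) :
    L.SubExpr x t k φ (subS x t φ) :=
  let ⟨n, _, h⟩ := exists_stage_E hφ
  subExpr_exists x ht n h hx

theorem subExprDefined (ht : IsTerm t) (hφ : φ ∈ L.E k) (hx : x ∈ dom k) :
    L.SubExprDefined k x t φ :=
  ⟨_, subExpr_of_expr ht hφ hx, fun _ h => h.eq_subS ht⟩

theorem subExpr_eq (ht : IsTerm t) (hφ : φ ∈ L.E k) (hx : x ∈ dom k) :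
    L.subExpr k x t φ = subS x t φ := by
  have h : ∃ φ', L.SubExpr x t k φ φ' := ⟨_, subExpr_of_expr ht hφ hx⟩
  rw [subExpr, dif_pos h]
  exact h.choose_spec.eq_subS ht

/-- The context `g` shows that `x` is not free in `φ`, and the context `k` that it is not bound. -/
theorem subS_eq_of_not_mem_dom (hφ : φ ∈ L.E k) {g : Ctx V C F} (hg : φ ∈ L.E g)
    (hx : x ∈ dom k) (hxg : x ∉ dom g) : subS x t φ = φ :=
  subS_eq_self (fun h => hxg (fvS_subset hg h))
    fun h => Set.disjoint_left.1 (disjoint_bvS hφ) h hx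

end

/-- The substitution in the part of a context that follows the variable `x`. -/
noncomputable def subTail (x : V) (t : Str V C F) (m : Ctx V C F) : Ctx V C F :=
  m.map fun p => (p.1, subS x t p.2)

@[simp] theorem dom_subTail (x : V) (t : Str V C F) (m : Ctx V C F) :
    dom (subTail x t m) = dom m := by
  ext z
  simp [dom, subTail]

theorem subTail_append (x : V) (t : Str V C F) (m m' : Ctx V C F) :
    subTail x t (m ++ m') = subTail x t m ++ subTail x t m' := List.map_append

theorem subTail_singleton (x : V) (t : Str V C F) (y : V) (φ : Str V C F) :
    subTail x t [(y, φ)] = [(y, subS x t φ)] := rfl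

/-- Variables of a context do not repeat, so the place of `x` is determined; a clause applied at the
wrong place contradicts freshness. -/
theorem SubCtx.eq_subTail {x : V} {t : Str V C F} (ht : IsTerm t) {k k' : Ctx V C F}
    (hs : L.SubCtx x t k k') : ∀ {h m : Ctx V C F} {χ : Str V C F}, k = h ++ (x, χ) :: m →
      k' = h ++ subTail x t m := by
  induction hs with
  | last k h' χ' hk hk' =>
    intro h m χ heq
    subst hk'
    rcases List.eq_nil_or_concat' m with rfl | ⟨m, q, rfl⟩
    · obtain ⟨h1, -⟩ := List.append_inj' heq rfl
      simp [h1, subTail]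
    · rw [← List.cons_append, ← List.append_assoc] at heq
      obtain ⟨rfl, -⟩ := List.append_inj' heq rfl
      exact (fresh_of_mem_K hk (by simp)).elim
  | step k h' h'' y χ' χ'' hk hk' hx hsub he ih =>
    intro h m χ heq
    subst hk'
    rcases List.eq_nil_or_concat' m with rfl | ⟨m, q, rfl⟩
    · obtain ⟨rfl, h2⟩ := List.append_inj' heq rfl
      simp only [List.cons.injEq, Prod.mk.injEq, and_true] at h2
      exact (fresh_of_mem_K hk (h2.1 ▸ hx)).elim
    · rw [← List.cons_append, ← List.append_assoc] at heq
      obtain ⟨h1, h2⟩ := List.append_inj' heq rfl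
      simp only [List.cons.injEq, and_true] at h2
      rw [ih h1, he.eq_subS ht, ← h2, subTail_append, subTail_singleton, List.append_assoc]

theorem subCtx_exists {x : V} {t : Str V C F} (ht : IsTerm t) {h : Ctx V C F} {χ : Str V C F}
    (m : Ctx V C F) (hk : h ++ (x, χ) :: m ∈ L.K) :
    L.SubCtx x t (h ++ (x, χ) :: m) (h ++ subTail x t m) := by
  induction m using List.reverseRecOn with
  | nil =>
    rw [show h ++ subTail x t [] = h by simp [subTail]]
    exact .last _ h χ hk rfl
  | append_singleton m p ih =>
    rw [← List.cons_append, ← List.append_assoc] at hk ⊢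
    have hx : x ∈ dom (h ++ (x, χ) :: m) := by simp
    rw [subTail_append, ← List.append_assoc]
    exact .step _ _ _ p.1 p.2 _ hk rfl hx (ih (prefix_mem_K hk))
      (subExpr_of_expr ht (expr_of_mem_K (y := p.1) hk) hx)

section

variable {h m : Ctx V C F} {x : V} {χ t : Str V C F}

theorem subCtxDefined (ht : IsTerm t) (hk : h ++ (x, χ) :: m ∈ L.K) :
    L.SubCtxDefined (h ++ (x, χ) :: m) x t :=
  ⟨_, subCtx_exists ht m hk, fun _ hs => hs.eq_subTail ht rfl⟩

theorem subCtx_eq (ht : IsTerm t) (hk : h ++ (x, χ) :: m ∈ L.K) :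
    L.subCtx (h ++ (x, χ) :: m) x t = h ++ subTail x t m := by
  have hex : ∃ k', L.SubCtx x t (h ++ (x, χ) :: m) k' := ⟨_, subCtx_exists ht m hk⟩
  rw [subCtx, dif_pos hex]
  exact hex.choose_spec.eq_subTail ht rfl

/-! ### Substitution preserves contexts, expressions and meanings -/

theorem subTail_extend {l : ℕ} (y : Fin l → V) (ψs : Fin l → Str V C F) (j : ℕ) :
    h ++ subTail x t (extend m y ψs j) =
      extend (h ++ subTail x t m) y (fun a => subS x t (ψs a)) j := by
  simp [extend, subTail, List.map_take, List.map_ofFn, Function.comp_def]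

theorem extend_append_cons {l : ℕ} (p : V × Str V C F) (y : Fin l → V) (ψs : Fin l → Str V C F)
    (j : ℕ) : extend (h ++ p :: m) y ψs j = h ++ p :: extend m y ψs j := by
  simp [extend]

theorem forall_mem_extend {l : ℕ} {k : Ctx V C F} {y : Fin l → V} {ψs : Fin l → Str V C F}
    {P : V × Str V C F → Prop} (hk : ∀ p ∈ k, P p) (hy : ∀ a, P (y a, ψs a)) (j : ℕ) :
    ∀ p ∈ extend k y ψs j, P p := by
  intro p hp
  rcases List.mem_append.1 hp with hp | hp
  · exact hk p hp
  · obtain ⟨a, rfl⟩ := (List.mem_ofFn' _ _).1 (List.mem_of_mem_take hp)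
    exact hy a

-- The capture conditions come for free: the bound variables of `φ` avoid the domain of its context,
-- which contains `x` and the free variables of `t`.
open Classical in
theorem evalS_subS_of_expr (ht : t ∈ L.E h) {φ : Str V C F}
    (hφ : φ ∈ L.E (h ++ (x, χ) :: m)) (e : V → Obj.{u, w} A) :
    L.evalS (subS x t φ) e = L.evalS φ (Function.update e x (L.evalS t e)) := by
  have hd := disjoint_bvS hφ
  refine L.evalS_subS x (isTerm_of_expr ht) (isTerm_of_expr hφ)
    (hd.mono_right ((fvS_subset ht).trans (by rw [dom_append]; exact Set.subset_union_left))) (fun hx => ?_) e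
  exact Set.disjoint_left.1 hd hx (by simp)

-- Pairs before `x` do not see the update, the pair of `x` is handled by `hval`, and for a later
-- pair the substitution lemma turns membership in the substituted set into membership in the
-- original one.
open Classical in
theorem good_update (ht : t ∈ L.E h) (hval : ∀ e, L.Good h e → L.evalS t e ∈ L.evalS χ e)
    (hk : h ++ (x, χ) :: m ∈ L.K) {e : V → Obj.{u, w} A} (he : L.Good (h ++ subTail x t m) e) :
    L.Good (h ++ (x, χ) :: m) (Function.update e x (L.evalS t e)) := by
  rw [L.good_append] at he
  have hxh := fresh_of_mem_K hk
  have hh : Set.EqOn (Function.update e x (L.evalS t e)) e (dom h) := fun z hz =>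
    Function.update_of_ne (fun hzx : z = x => hxh (hzx ▸ hz)) _ _
  have hfv : ∀ p ∈ h, fvS p.2 ⊆ dom h := by
    obtain ⟨n, -, hn⟩ := ctx_of_expr ht
    exact (L.sound n).fv_ctx hn
  rw [L.good_append]
  refine ⟨(L.good_congr hfv hh).2 he.1, ?_⟩
  intro p hp
  rcases List.mem_cons.1 hp with rfl | hp
  · rw [L.evalS_congr χ (hh.mono (fvS_subset (expr_of_mem_K hk)))]
    simpa using hval e he.1
  · obtain ⟨m₁, m₂, rfl⟩ := List.append_of_mem hp
    have hk' : (h ++ (x, χ) :: m₁) ++ (p.1, p.2) :: m₂ ∈ L.K := by simpa using hk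
    have hpx : p.1 ≠ x := fun hpx => fresh_of_mem_K hk' (by simp [hpx])
    rw [← evalS_subS_of_expr ht (expr_of_mem_K hk'), Function.update_of_ne hpx]
    exact he.2 (p.1, subS x t p.2) (List.mem_map.2 ⟨p, by simp, rfl⟩)

/-- Contexts and expressions are treated in one induction on the step, since each kind is built from
the other. The tail `m` is general because a set builder lengthens it. -/
theorem subst_mem (ht : t ∈ L.E h) (hval : ∀ e, L.Good h e → L.evalS t e ∈ L.evalS χ e) (n : ℕ) :
    ∀ m : Ctx V C F, h ++ (x, χ) :: m ∈ (L.stage n).K →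
      (∀ p ∈ m, p.1 ∉ bvS t ∧ Disjoint (bvS t) (bvS p.2)) →
      h ++ subTail x t m ∈ L.K ∧
      ∀ φ ∈ (L.stage n).E (h ++ (x, χ) :: m), Disjoint (bvS t) (bvS φ) →
        subS x t φ ∈ L.E (h ++ subTail x t m) := by
  classical
  have hfirst : ∀ m : Ctx V C F, h ++ (x, χ) :: m ∉ L.first.K := fun m h => by simp [first] at h
  have htT := isTerm_of_expr ht
  induction n using stage_induction with
  | h0 => exact fun m hk => (hfirst m hk).elim
  | h1 => exact fun m hk => (hfirst m hk).elim
  | hs n hn ih =>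
    intro m hk hm
    have hS := L.sound n
    -- a context which ends with a new variable
    have hsnoc : ∀ {g : Ctx V C F} {y : V} {ψ : Str V C F}, (L.stage n).CtxWF g y ψ →
        h ++ (x, χ) :: m = g ++ [(y, ψ)] →
        (m = [] ∧ g = h ∧ y = x) ∨ ∃ m₀, m = m₀ ++ [(y, ψ)] ∧ g = h ++ (x, χ) :: m₀ ∧ y ≠ x ∧
          y ∉ bvS t ∧ (∀ p ∈ m₀, p.1 ∉ bvS t ∧ Disjoint (bvS t) (bvS p.2)) ∧
          subS x t ψ ∈ L.E (h ++ subTail x t m₀) ∧ y ∉ dom (h ++ subTail x t m₀) ∧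
          ∀ e, L.Good (h ++ subTail x t m₀) e → (L.evalS (subS x t ψ) e).IsSet := by
      intro g y ψ hw heq
      rcases List.eq_nil_or_concat' m with rfl | ⟨m₀, q, rfl⟩
      · obtain ⟨h1, h2⟩ := List.append_inj' heq rfl
        simp only [List.cons.injEq, Prod.mk.injEq, and_true] at h2
        exact Or.inl ⟨rfl, h1.symm, h2.1.symm⟩
      · rw [← List.cons_append, ← List.append_assoc] at heq
        obtain ⟨rfl, h2⟩ := List.append_inj' heq rfl
        simp only [List.cons.injEq, and_true] at h2
        subst h2
        have hm₀ : ∀ p ∈ m₀, p.1 ∉ bvS t ∧ Disjoint (bvS t) (bvS p.2) :=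
          fun p hp => hm p (by simp [hp])
        obtain ⟨hy, hψ⟩ := hm (y, ψ) (by simp)
        have hfr := hw.fresh
        simp only [dom_append, dom_cons, Set.mem_union, Set.mem_insert_iff, not_or] at hfr
        refine Or.inr ⟨m₀, rfl, rfl, hfr.2.1, hy, hm₀, (ih m₀ hw.ctx hm₀).2 ψ hw.expr hψ,
          by simp [hfr], fun e he => ?_⟩
        rw [evalS_subS_of_expr ht (L.mem_E_of_stage hw.expr)]
        exact (hS.ctxWF_iff.1 hw).2.2 _ (good_update ht hval (L.mem_K_of_stage hw.ctx) he)
    rw [L.stage_succ hn] at hk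
    refine ⟨?_, fun φ hφ hd => ?_⟩
    · rcases hk with hk | ⟨g, y, ψ, hw, heq⟩
      · exact (ih m hk hm).1
      · rcases hsnoc hw heq with ⟨rfl, -, -⟩ | ⟨m₀, rfl, -, -, -, -, h1, h2, h3⟩
        · simpa [subTail] using ctx_of_expr ht
        · rw [subTail_append, subTail_singleton, ← List.append_assoc]
          exact snoc_mem_K h1 h2 h3
    · rw [L.stage_succ hn] at hφ
      rcases hφ with (((((hφ | ⟨g, y, ψ, hw, heq, hφ, hy⟩) | ⟨g, y, ψ, hw, heq, rfl⟩) |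
        ⟨l, ψ, ψs, hw, rfl⟩) | ⟨l, f, ψs, hw, rfl⟩) | ⟨l, y, ψs, ψ, hw, rfl⟩)
      · exact (ih m hφ.1 hm).2 φ hφ.2 hd
      · rw [hS.vb hφ] at hy
        rcases hsnoc hw heq with ⟨rfl, rfl, rfl⟩ | ⟨m₀, rfl, rfl, -, hyt, hm₀, h1, h2, h3⟩
        · rw [subS_eq_self (fun hf => hw.fresh (hS.fv hφ hf)) hy]
          simpa [subTail] using L.mem_E_of_stage hφ
        · rw [subTail_append, subTail_singleton, ← List.append_assoc]
          -- The variable `y` is bound neither in `φ` nor in `t`, hence not in the replaced string.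
          refine weaken_mem_E h1 h2 h3 ((ih m₀ hw.ctx hm₀).2 φ hφ hd) fun hb => ?_
          exact (bvS_subS x htT (hS.isTerm hφ) hb).elim hy hyt
      · rcases hsnoc hw heq with ⟨rfl, rfl, rfl⟩ | ⟨m₀, rfl, rfl, hyx, -, -, h1, h2, h3⟩
        -- With no pair after `x`, the new context is `h`, of which `t` is an expression by
        -- hypothesis.
        · rw [subS_var_self y htT]
          simpa [subTail] using ht
        · rw [subS_var_of_ne x htT hyx, subTail_append, subTail_singleton, ← List.append_assoc]
          exact var_mem_E h1 h2 h3
      · have hT := hS.isTerm hw.head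
        have hTs := fun j => hS.isTerm (hw.args j)
        rw [bvS_app hT hTs, Set.disjoint_union_right, Set.disjoint_iUnion_right] at hd
        rw [subS_app x htT hT hTs]
        obtain ⟨-, hE⟩ := ih m hw.ctx hm
        obtain ⟨-, -, -, h1, h2⟩ := hS.appWF_iff.1 hw
        have hgood := fun e he => good_update ht hval (L.mem_K_of_stage hw.ctx) (e := e) he
        refine app_mem_E hw.pos (hE ψ hw.head hd.1) (fun j => hE _ (hw.args j) (hd.2 j))
          (fun e he => ?_) fun e he => ?_
        · rw [evalS_subS_of_expr ht (L.mem_E_of_stage hw.head)]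
          exact h1 _ (hgood e he)
        · simp only [evalS_subS_of_expr ht (L.mem_E_of_stage hw.head),
            fun j => evalS_subS_of_expr ht (L.mem_E_of_stage (hw.args j))]
          exact h2 _ (hgood e he)
      · have hTs := fun j => hS.isTerm (hw.args j)
        rw [bvS_op f hTs, Set.disjoint_iUnion_right] at hd
        rw [subS_op x htT f hTs]
        obtain ⟨-, hE⟩ := ih m hw.ctx hm
        refine op_mem_E hw.pos (fun j => hE _ (hw.args j) (hd j)) fun e he => ?_
        simp only [fun j => evalS_subS_of_expr ht (L.mem_E_of_stage (hw.args j))]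
        exact (hS.opWF_iff.1 hw).2.2 _ (good_update ht hval (L.mem_K_of_stage hw.ctx) he)
      · have hT := hS.isTerm hw.body
        have hTs := fun j => hS.isTerm (hw.exprs j)
        rw [bvS_set y hT hTs, Set.disjoint_union_right, Set.disjoint_union_right,
          Set.disjoint_iUnion_right] at hd
        rw [subS_set x htT y hT hTs]
        obtain ⟨⟨hdy, hds⟩, hdψ⟩ := hd
        have hyt : ∀ j, y j ∉ bvS t := fun j hj => Set.disjoint_left.1 hdy hj ⟨j, rfl⟩
        obtain ⟨hl, hinj, hfresh, hexprs, hset, hbody⟩ := hS.setWF_iff.1 hw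
        -- The bound variables of a set builder include its binders and those of the `ψs j`, so
        -- their disjointness from the bound variables of `t` is just what the lengthened tail
        -- needs.
        have hm' := fun j => forall_mem_extend (P := fun p => p.1 ∉ bvS t ∧
          Disjoint (bvS t) (bvS p.2)) hm (fun a => ⟨hyt a, hds a⟩) j
        simp only [extend_append_cons] at hexprs hset hbody
        refine set_mem_E hl hinj (fun j => ?_) (fun j => ?_) (fun j e he => ?_) ?_
        · have := hfresh j
          simp only [dom_append, dom_cons, Set.mem_union, Set.mem_insert_iff, not_or] at this
          simp [this]
        · rw [← subTail_extend]
          exact (ih _ (hS.ctx_of_expr (hexprs j)) (hm' j)).2 _ (hexprs j) (hds j)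
        · rw [← subTail_extend] at he
          rw [evalS_subS_of_expr ht (L.mem_E_of_stage (hexprs j))]
          exact hset j _ (good_update ht hval
            (L.mem_K_of_stage (hS.ctx_of_expr (hexprs j))) he)
        · rw [← subTail_extend]
          exact (ih _ (hS.ctx_of_expr hbody) (hm' l)).2 _ hbody hdψ

end

end Lang
-- Decomposition of contexts, the state `σ_ρ`, and the shapes of substituted expressions
namespace Lang

variable {V C F : Type*} {A : Type w} {L : Lang.{u, w} V C F A}

theorem decomposition {n : ℕ} (hn : 2 ≤ n) {k : Ctx V C F} (hk : k ∈ (L.stage n).K)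
    (hne : k ≠ []) : L.Decomposition n k := by
  have hsplit : ∀ i : Fin k.length,
      k.take i ++ ((k.get i).1, (k.get i).2) :: k.drop (i + 1) = k := by
    intro i
    simp
  have hw : ∀ i : Fin k.length,
      (L.stage (n - 1)).CtxWF (k.take i) (k.get i).1 (k.get i).2 := fun i =>
    ctxWF_of_stage n (by rw [hsplit i]; exact hk)
  have hE := fun i => L.mem_E_of_stage (hw i).expr
  have hK := L.mem_K_of_stage hk
  refine ⟨List.length_pos_iff.2 hne, length_lt_of_stage n (by omega) hk, nodup_of_mem_K hK,
    fun i => (hw i).ctx, fun i => (hw i).expr, fun i => ?_, fun σ hσ => ?_⟩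
  · rw [forall_Xi (ctx_of_expr (hE i))]
    intro e he
    rw [den_mkState (hE i) he]
    exact ((L.sound _).ctxWF_iff.1 (hw i)).2.2 e he
  · obtain ⟨e, he, rfl⟩ := (mem_Xi_iff hK σ).1 hσ
    refine ⟨fun i => e (k.get i).1, ?_, fun i => ?_⟩
    · exact List.ext_getElem (by simp [mkState]) fun j h1 h2 => by simp [mkState]
    · have hi := hsplit i
      have hr : restr (mkState k e) (dom (k.take i)) = mkState (k.take i) e := by
        have := restr_mkState_append (k.take i) (k.drop i) e
          (fresh_right_of_mem_K (L := L) (by rwa [List.take_append_drop]))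
        rwa [List.take_append_drop] at this
      have hg : L.Good (k.take i) e := fun p hp => he p (List.mem_of_mem_take hp)
      rw [hr, den_mkState (hE i) hg]
      exact he _ (List.get_mem k i)

section

variable {h m : Ctx V C F} {x : V} {χ t : Str V C F}

-- Turns `σ_ρ` into an updated assignment. The variables other than `x` all remain in the domain of
-- the substituted context, so `val` returns their values there.
open Classical in
theorem insertState_mkState (ht : t ∈ L.E h)
    (hk' : h ++ subTail x t m ∈ L.K) {e : V → Obj.{u, w} A}
    (he : L.Good (h ++ subTail x t m) e) :
    L.insertState (h ++ (x, χ) :: m) h x t (mkState (h ++ subTail x t m) e) =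
      mkState (h ++ (x, χ) :: m) (Function.update e x (L.evalS t e)) := by
  rw [insertState, restr_mkState_append _ _ _ (fresh_right_of_mem_K hk'),
    den_mkState ht (L.good_append.1 he).1]
  refine List.map_congr_left fun p hp => ?_
  by_cases hpx : p.1 = x
  · simp [hpx]
  · rw [if_neg hpx, Function.update_of_ne hpx, val_mkState]
    have := fst_mem_dom hp
    simpa [hpx] using this

/-- Let `κ` be the segment where `φ` was built. If `x` is in `dom κ`, substitution with respect to
`κ` and to `k` is the same replacement; if not, `x` does not occur in `φ`. -/
theorem subShape {n : ℕ} {k : Ctx V C F} {φ : Str V C F} (ht : IsTerm t) (hVb : L.Vb t = bvS t)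
    (hφ : φ ∈ (L.stage n).E k) (hx : x ∈ dom k) (hd : Disjoint (bvS t) (bvS φ)) :
    L.SubShape n k x t φ := by
  have hE := L.mem_E_of_stage hφ
  have hle := L.stage_le (Nat.sub_le n 1)
  have hS := L.sound (n - 1)
  have hsub := subExpr_eq ht hE hx
  have hself : ∀ κ : Ctx V C F, φ ∈ (L.stage n).E κ → x ∉ dom κ → L.subExpr k x t φ = φ :=
    fun κ h1 h2 => hsub.trans (subS_eq_of_not_mem_dom hE (L.mem_E_of_stage h1) hx h2)
  cases formed_of_stage n hφ with
  | const c hc => exact .const c hc (hsub.trans (by rw [hc, subS_const x ht]))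
  | var z hz hzd =>
    refine .var z hz hzd (fun hzx => ?_) fun hzx => ?_
    · rw [hsub, hz, hzx, subS_var_self x ht]
    · rw [hsub, hz, subS_var_of_ne x ht hzx]
  | app κ l ψ ψs hκ hw hφ' hφκ =>
    refine .app κ l ψ ψs hκ hw hφ' hφκ (fun hxκ => ?_) (hself κ hφκ)
    have h1 := L.mem_E_of_stage hw.head
    have h2 := fun j => L.mem_E_of_stage (hw.args j)
    refine ⟨subExprDefined ht h1 hxκ, fun j => subExprDefined ht (h2 j) hxκ, ?_⟩
    simp only [subExpr_eq ht h1 hxκ, fun j => subExpr_eq ht (h2 j) hxκ]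
    rw [hsub, hφ', subS_app x ht (isTerm_of_expr h1) fun j => isTerm_of_expr (h2 j)]
  | op κ l f ψs hκ hw hφ' hφκ =>
    refine .op κ l f ψs hκ hw hφ' hφκ (fun hxκ => ?_) (hself κ hφκ)
    have h2 := fun j => L.mem_E_of_stage (hw.args j)
    refine ⟨fun j => subExprDefined ht (h2 j) hxκ, ?_⟩
    simp only [fun j => subExpr_eq ht (h2 j) hxκ]
    rw [hsub, hφ', subS_op x ht f fun j => isTerm_of_expr (h2 j)]
  | set κ l y ψs ψ hκ hw hφ' hφκ =>
    refine .set κ l y ψs ψ hκ hw hφ' hφκ (fun hxκ => ?_) (hself κ hφκ)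
    have h1 := L.mem_E_of_stage hw.body
    have h2 := fun j => L.mem_E_of_stage (hw.exprs j)
    have hx' : ∀ j, x ∈ dom (extend κ y ψs j) := fun j => dom_subset_dom_extend _ _ _ _ hxκ
    rw [hφ', bvS_set y (isTerm_of_expr h1) fun j => isTerm_of_expr (h2 j),
      Set.disjoint_union_right, Set.disjoint_union_right, Set.disjoint_iUnion_right] at hd
    obtain ⟨⟨hdy, hds⟩, hdψ⟩ := hd
    rw [hVb]
    refine ⟨fun j => ⟨fun hj => Set.disjoint_left.1 hdy hj ⟨j, rfl⟩, hle.expr _ (hw.exprs j), ?_,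
      subExprDefined ht (h2 j) (hx' j)⟩, hle.expr _ hw.body, ?_, subExprDefined ht h1 (hx' l), ?_⟩
    · rw [Vb_eq (h2 j)]
      exact hds j
    · rw [Vb_eq h1]
      exact hdψ
    · simp only [subExpr_eq ht h1 (hx' l), fun j : Fin l => subExpr_eq ht (h2 j) (hx' j)]
      rw [hsub, hφ', subS_set x ht y (isTerm_of_expr h1) fun j => isTerm_of_expr (h2 j)]

end

end Lang

end SubstLogic

/-! ### The theorem -/

theorem mainTheorem6 {V C F : Type*} {A : Type w} (L : Lang.{u, w} V C F A)
    (n : ℕ) (hn : 2 ≤ n) (k : Ctx V C F) (hk : k ∈ (L.stage n).K) (hne : k ≠ []) :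
    L.Decomposition n k ∧
    ∀ (h : Ctx V C F) (x : V) (χ : Str V C F) (m : Ctx V C F), k = h ++ (x, χ) :: m →
    ∀ t ∈ L.E h,
      (∀ ρ ∈ L.Xi h, L.den h t ρ ∈ L.den h χ ρ) →
      (∀ p ∈ h ++ m, p.1 ∉ L.Vb t) →
      (∀ p ∈ m, Disjoint (L.Vb t) (L.Vb p.2)) →
      -- the substituted context
      L.SubCtxDefined k x t ∧
      (m = [] → L.subCtx k x t = h) ∧
      (∀ (m₀ : Ctx V C F) (y : V) (ψ : Str V C F), m = m₀ ++ [(y, ψ)] →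
        let g : Ctx V C F := h ++ (x, χ) :: m₀
        L.SubCtxDefined g x t ∧ L.subCtx g x t ∈ L.K ∧
        y ∉ dom (L.subCtx g x t) ∧
        L.SubExprDefined g x t ψ ∧ L.subExpr g x t ψ ∈ L.E (L.subCtx g x t) ∧
        (∀ ρ ∈ L.Xi (L.subCtx g x t),
          (L.den (L.subCtx g x t) (L.subExpr g x t ψ) ρ).IsSet) ∧
        L.subCtx k x t = L.subCtx g x t ++ [(y, L.subExpr g x t ψ)]) ∧
      dom (L.subCtx k x t) = dom k \ {x} ∧
      L.subCtx k x t ∈ L.K ∧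
      (∀ ρ ∈ L.Xi (L.subCtx k x t),
        restr ρ (dom h) ∈ L.Xi h ∧ L.insertState k h x t ρ ∈ L.Xi k) ∧
      -- the substituted expressions
      ∀ φ ∈ (L.stage n).E k, Disjoint (L.Vb t) (L.Vb φ) →
        L.SubExprDefined k x t φ ∧
        L.subExpr k x t φ ∈ L.E (L.subCtx k x t) ∧
        (∀ ρ ∈ L.Xi (L.subCtx k x t),
          L.den k φ (L.insertState k h x t ρ) =
            L.den (L.subCtx k x t) (L.subExpr k x t φ) ρ) ∧
        L.Vb (L.subExpr k x t φ) ⊆ L.Vb φ ∪ L.Vb t ∧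
        L.SubShape n k x t φ ∧
        -- independence of the ambient context
        (∀ m' : Ctx V C F, h ++ (x, χ) :: m' ∈ (L.stage n).K →
          (∀ p ∈ m', p.1 ∉ L.Vb t ∧ Disjoint (L.Vb t) (L.Vb p.2)) →
          φ ∈ (L.stage n).E (h ++ (x, χ) :: m') →
          L.SubExprDefined (h ++ (x, χ) :: m') x t φ ∧
          L.subExpr k x t φ = L.subExpr (h ++ (x, χ) :: m') x t φ) ∧
        -- a variable outside a context of the expression
        (∀ g ∈ (L.stage n).K, φ ∈ (L.stage n).E g → x ∉ dom g → L.subExpr k x t φ = φ) := by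
  classical
  refine ⟨Lang.decomposition hn hk hne, ?_⟩
  rintro h x χ m rfl t ht hval hV hVm
  have htT := Lang.isTerm_of_expr ht
  have hVt := Lang.Vb_eq ht
  rw [hVt] at hV hVm ⊢
  have hK := L.mem_K_of_stage hk
  have hχ : χ ∈ L.E h := Lang.expr_of_mem_K hK
  have hval' : ∀ e, L.Good h e → L.evalS t e ∈ L.evalS χ e := by
    intro e he
    have := (Lang.forall_Xi (Lang.ctx_of_expr ht)).1 hval e he
    rwa [Lang.den_mkState ht he, Lang.den_mkState hχ he] at this
  have hm : ∀ p ∈ m, p.1 ∉ bvS t ∧ Disjoint (bvS t) (bvS p.2) := by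
    intro p hp
    refine ⟨hV p (by simp [hp]), ?_⟩
    obtain ⟨m₁, m₂, rfl⟩ := List.append_of_mem hp
    have hKp : (h ++ (x, χ) :: m₁) ++ (p.1, p.2) :: m₂ ∈ L.K := by simpa using hK
    rw [← Lang.Vb_eq (Lang.expr_of_mem_K hKp)]
    exact hVm p hp
  have hxd : ∀ m : Ctx V C F, x ∈ dom (h ++ (x, χ) :: m) := fun m => by simp
  obtain ⟨hK', hE'⟩ := Lang.subst_mem ht hval' n m hk hm
  have hsc := Lang.subCtx_eq htT hK
  refine ⟨Lang.subCtxDefined htT hK, ?_, ?_, ?_, ?_, ?_, ?_⟩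
  · rintro rfl
    simp [hsc, Lang.subTail]
  · rintro m₀ y ψ rfl
    have hk₀ : (h ++ (x, χ) :: m₀) ++ (y, ψ) :: [] ∈ (L.stage n).K := by simpa using hk
    have hw := Lang.ctxWF_of_stage' hk₀
    have hψ := L.mem_E_of_stage hw.expr
    have hK₀ := L.mem_K_of_stage hw.ctx
    obtain ⟨h1, h2⟩ := Lang.subst_mem ht hval' n m₀ hw.ctx fun p hp => hm p (by simp [hp])
    intro g
    rw [hsc, Lang.subCtx_eq htT hK₀, Lang.subExpr_eq htT hψ (hxd m₀)]
    have hψ' := h2 ψ hw.expr (hm (y, ψ) (by simp)).2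
    refine ⟨Lang.subCtxDefined htT hK₀, h1, ?_, Lang.subExprDefined htT hψ (hxd m₀), hψ', ?_, ?_⟩
    · have := hw.fresh
      simp only [dom_append, dom_cons, Set.mem_union, Set.mem_insert_iff, not_or] at this
      simp [this]
    · rw [Lang.forall_Xi h1]
      intro e he
      rw [Lang.den_mkState hψ' he, Lang.evalS_subS_of_expr ht hψ]
      exact ((L.sound n).ctxWF_iff.1 hw).2.2 _ (Lang.good_update ht hval' hK₀ he)
    · rw [Lang.subTail_append, Lang.subTail_singleton, List.append_assoc]
  · have hx1 := Lang.fresh_of_mem_K hK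
    have hx2 : x ∉ dom m := by
      rintro ⟨p, hp, rfl⟩
      have hK2 : (h ++ [(p.1, χ)]) ++ m ∈ L.K := by simpa using hK
      exact Lang.fresh_right_of_mem_K hK2 p hp (by simp)
    rw [hsc]
    ext z
    simp only [dom_append, Lang.dom_subTail, dom_cons, Set.mem_union, Set.mem_sdiff,
      Set.mem_insert_iff, Set.mem_singleton_iff]
    by_cases hz : z = x
    · subst hz
      simp [hx1, hx2]
    · simp [hz]
  · rwa [hsc]
  · rw [hsc, Lang.forall_Xi hK']
    intro e he
    rw [restr_mkState_append _ _ _ (Lang.fresh_right_of_mem_K hK'),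
      Lang.insertState_mkState ht hK' he]
    exact ⟨(Lang.mem_Xi_iff (Lang.ctx_of_expr ht) _).2 ⟨e, (L.good_append.1 he).1, rfl⟩,
      (Lang.mem_Xi_iff hK _).2 ⟨_, Lang.good_update ht hval' hK he, rfl⟩⟩
  · intro φ hφ hd
    have hφE := L.mem_E_of_stage hφ
    rw [Lang.Vb_eq hφE] at hd ⊢
    have hφ' := hE' φ hφ hd
    refine ⟨Lang.subExprDefined htT hφE (hxd m), ?_, ?_, ?_,
      Lang.subShape htT hVt hφ (hxd m) hd, ?_, ?_⟩
    all_goals rw [Lang.subExpr_eq htT hφE (hxd m)]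
    · rwa [hsc]
    · rw [hsc, Lang.forall_Xi hK']
      intro e he
      -- Both sides become the value of `φ` under `e` updated at `x` by the value of `t`.
      rw [Lang.insertState_mkState ht hK' he, Lang.den_mkState hφ' he,
        Lang.den_mkState hφE (Lang.good_update ht hval' hK he), Lang.evalS_subS_of_expr ht hφE]
    · rw [Lang.Vb_eq hφ']
      exact bvS_subS x htT (Lang.isTerm_of_expr hφE)
    -- Both substitutions are `subS x t φ`, in which no context occurs.
    · intro m' _ _ hφm
      have := L.mem_E_of_stage hφm
      exact ⟨Lang.subExprDefined htT this (hxd m'), (Lang.subExpr_eq htT this (hxd m')).symm⟩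
    · intro g _ hφg hxg
      exact Lang.subS_eq_of_not_mem_dom hφE (L.mem_E_of_stage hφg) (hxd m) hxg
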